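/- For $1\le m$ and an interval $J$ with endpoints $a<b$, let $L_2^m(J)$ be the space of functions $f:J\to\mathbb{R}$ whose derivative $f^{(m-1)}$ is absolutely continuous and whose derivative $f^{(m)}$ (defined almost everywhere) is square integrable; for open $J=(a,b)$ this means that $f$ extends to an element of $L_2^m([a,b])$. Write $L_2^m=L_2^m([-1,1])$ and $\|g\|_2=\left(\int_{-1}^1|g(x)|^2\,dx\right)^{1/2}$. Let $r\ge 1$ and $0\le k\le r-1$ be integers and let $t\in(-1,1)$. Put $W_2^r=\{f\in L_2^r : \|f^{(r)}\|_2\le 1\}$. Let $\Gamma_t$ be the set of all pairs $(A,B)$ of non-negative real numbers such that $$|f^{(k)}(t)|\le A\|f\|_2+B\|f^{(r)}\|_2\qquad\text{for every } f\in L_2^r,$$ and such that this inequality is sharp in the sense that $$B=\sup_{f\in W_2^r}\left(|f^{(k)}(t)|-A\|f\|_2\right).$$ Theorem. For every $\lambda\ge 0$ the boundary value problem $$\begin{cases}(-1)^r u^{(2r)}(x)+\lambda u(x)=0, & x\in(-1,t)\cup(t,1),\\ u^{(s)}(-1)=u^{(s)}(1)=0, & s=0,1,\dots,r-1,\\ u^{(s)}(t+0)-u^{(s)}(t-0)=(-1)^{k-1}\delta_{r-k-1,s},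 & s=0,1,\dots,2r-1,\end{cases}$$ where $\delta$ is the Kronecker symbol, has a solution $u_{\lambda,t}$ in $L_2^{2r}((-1,t))\cap L_2^{2r}((t,1))$, and this solution is unique as a function on $(-1,t)\cup(t,1)$. Moreover, $$\Gamma_t=\left\{\left(\|u_{\lambda,t}^{(r)}\|_2,\ \|u_{\lambda,t}\|_2\right) : \lambda\ge 0\right\},$$ where $u_{\lambda,t}^{(r)}$ is the derivative taken on $(-1,t)\cup(t,1)$. -/

import Mathlib

open Set Filter Topology MeasureTheory

namespace LandauKolmogorov

/-- The norm of `L_2([-1,1])`. -/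
noncomputable def l2norm (g : ℝ → ℝ) : ℝ :=
  Real.sqrt (∫ x in (-1 : ℝ)..1, |g x| ^ 2)

/-- `f ∈ L_2^r([a,b])`, for `a < b` and `r ≥ 1`: the derivatives of `f` on `[a,b]` up to order
`r - 1` exist and are continuous (one-sided derivatives at the endpoints), `f^{(r-1)}` is
absolutely continuous on `[a,b]`, and its almost everywhere defined derivative `f^{(r)}` is
square integrable. -/
def MemSobolev (a b : ℝ) (r : ℕ) (f : ℝ → ℝ) : Prop :=
  ContDiffOn ℝ ((r - 1 : ℕ) : WithTop ℕ∞) f (Icc a b) ∧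
  AbsolutelyContinuousOnInterval (iteratedDerivWithin (r - 1) f (Icc a b)) a b ∧
  MemLp (iteratedDerivWithin r f (Icc a b)) 2 (volume.restrict (Icc a b))

/-- `u ∈ L_2^r((a,b))`: the restriction of `u` to the open interval `(a,b)` extends to an element
of `L_2^r([a,b])`. The values of `u` outside of `(a,b)` play no role. -/
def MemSobolevIoo (a b : ℝ) (r : ℕ) (u : ℝ → ℝ) : Prop :=
  ∃ g : ℝ → ℝ, MemSobolev a b r g ∧ EqOn u g (Ioo a b)

/-- The `j`-th derivative of a function on the interval `[-1,1]`. -/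
noncomputable def derivI (j : ℕ) (f : ℝ → ℝ) : ℝ → ℝ :=
  iteratedDerivWithin j f (Icc (-1) 1)

/-- The class `W^r_2` of all `f ∈ L_2^r([-1,1])` with `‖f^{(r)}‖₂ ≤ 1`. -/
def classW (r : ℕ) : Set (ℝ → ℝ) :=
  {f | MemSobolev (-1) 1 r f ∧ l2norm (derivI r f) ≤ 1}

/-- The set `Γ(D^k_t; L_2^r)` of all pairs `(A,B)` of non-negative numbers such that
`|f^{(k)}(t)| ≤ A ‖f‖₂ + B ‖f^{(r)}‖₂` for every `f ∈ L_2^r([-1,1])`, and the inequality is sharp,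
that is, `B` is the supremum of `|f^{(k)}(t)| - A ‖f‖₂` over `f ∈ W^r_2`. -/
def sharpPairs (r k : ℕ) (t : ℝ) : Set (ℝ × ℝ) :=
  {p | 0 ≤ p.1 ∧ 0 ≤ p.2 ∧
    (∀ f : ℝ → ℝ, MemSobolev (-1) 1 r f →
      |derivI k f t| ≤ p.1 * l2norm f + p.2 * l2norm (derivI r f)) ∧
    IsLUB ((fun f : ℝ → ℝ => |derivI k f t| - p.1 * l2norm f) '' classW r) p.2}

/-- `u` is a solution, in `L_2^{2r}((-1,t)) ∩ L_2^{2r}((t,1))`, of the boundary value problem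
`(-1)^r u^{(2r)} + lam u = 0` on `(-1,t) ∪ (t,1)`, `u^{(s)}(-1) = u^{(s)}(1) = 0` for `0 ≤ s < r`,
`u^{(s)}(t+0) - u^{(s)}(t-0) = (-1)^{k-1} δ_{r-k-1,s}` for `0 ≤ s < 2r`.
Boundary values are one-sided limits from inside the two open intervals; the values of `u` outside
of these intervals play no role. The sign `(-1)^{k-1}` is written `(-1)^{k+1}`. -/
structure IsSolution (r k : ℕ) (t lam : ℝ) (u : ℝ → ℝ) : Prop where
  mem_left : MemSobolevIoo (-1) t (2 * r) u
  mem_right : MemSobolevIoo t 1 (2 * r) u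
  equation : ∀ x ∈ Ioo (-1) t ∪ Ioo t 1,
    (-1) ^ r * iteratedDeriv (2 * r) u x + lam * u x = 0
  left_end : ∀ s < r, Tendsto (iteratedDeriv s u) (𝓝[>] (-1)) (𝓝 0)
  right_end : ∀ s < r, Tendsto (iteratedDeriv s u) (𝓝[<] 1) (𝓝 0)
  jump : ∀ s < 2 * r, ∃ p m : ℝ,
    Tendsto (iteratedDeriv s u) (𝓝[>] t) (𝓝 p) ∧
    Tendsto (iteratedDeriv s u) (𝓝[<] t) (𝓝 m) ∧
    p - m = if s = r - k - 1 then (-1) ^ (k + 1) else 0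

end LandauKolmogorov

/-! For a solution u with parameter λ put A(λ) = ‖u^{(r)}‖₂ and B(λ) = ‖u‖₂. The end conditions and
the jump at t are those for which Green's formula on the two subintervals gives f^{(k)}(t) =
(-1)^{r+1} ∫ u f^{(r)} + ∫ u^{(r)} f (`IsKernel.represents`), and Cauchy–Schwarz yields the
inequality with constants A(λ), B(λ). Derivatives of u of orders r, …, 2r-1 do not jump, so u^{(r)}
belongs to L_2^r, with r-th derivative (-1)^{r+1} λ u. For λ > 0 this function gives equality. For λ
= 0 it is replaced by N u^{(r)} + E with E^{(r)} = (-1)^{r+1} u and N large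
(`Represents.l2norm_zero_le_of_forall_le`).

Conversely, the first entry of a sharp pair determines the second, so it suffices that A(λ) attains
every admissible first entry. Testing on u^{(r)} for λ = 0, whose r-th derivative vanishes, shows
that an admissible entry is at least A(0). Testing the representation for one parameter on the
u^{(r)} of another gives continuity of A (`Represents.sq_sub_le`), and `exists_lt_l2norm_mid` shows
that A is unbounded; the intermediate value theorem finishes.

Solvability and uniqueness of the boundary value problem both come from an energy identity
(`DerivTower.eq_zero_of_bvp`): the homogeneous problem has only the zero solution, and existence
follows by counting dimensions. -/

namespace LandauKolmogorov

/-! ### Towers of derivatives and Green's formula -/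

/-- `F 0, F 1, …, F n` are successive derivatives on `[a, b]`: the first `n` functions are
absolutely continuous, each is almost everywhere the derivative of its predecessor, and the last
one is square integrable. -/
structure DerivTower (n : ℕ) (F : ℕ → ℝ → ℝ) (a b : ℝ) : Prop where
  ac : ∀ i < n, AbsolutelyContinuousOnInterval (F i) a b
  ae_hasDerivAt : ∀ i < n, ∀ᵐ x, x ∈ Icc a b → HasDerivAt (F i) (F (i + 1) x) x
  memLp_last : MemLp (F n) 2 (volume.restrict (Icc a b))

theorem memLp_of_continuousOn_Icc {f : ℝ → ℝ} {a b : ℝ} (hf : ContinuousOn f (Icc a b)) :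
    MemLp f 2 (volume.restrict (Icc a b)) := by
  obtain ⟨C, hC⟩ := isCompact_Icc.exists_bound_of_continuousOn hf
  refine MemLp.of_bound (hf.aestronglyMeasurable measurableSet_Icc) C ?_
  exact (ae_restrict_iff' measurableSet_Icc).2 (ae_of_all _ hC)

theorem intervalIntegrable_mul_of_memLp {f g : ℝ → ℝ} {a b : ℝ} (hab : a ≤ b)
    (hf : MemLp f 2 (volume.restrict (Icc a b))) (hg : MemLp g 2 (volume.restrict (Icc a b))) :
    IntervalIntegrable (fun x => f x * g x) volume a b := by
  rw [intervalIntegrable_iff_integrableOn_Icc_of_le hab]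
  exact hf.integrable_mul hg

theorem intervalIntegrable_of_memLp {f : ℝ → ℝ} {a b : ℝ} (hab : a ≤ b)
    (hf : MemLp f 2 (volume.restrict (Icc a b))) : IntervalIntegrable f volume a b := by
  rw [intervalIntegrable_iff_integrableOn_Icc_of_le hab]
  exact hf.integrable (by norm_num)

namespace DerivTower

variable {n m : ℕ} {F V : ℕ → ℝ → ℝ} {a b c d : ℝ}

theorem continuousOn (hab : a ≤ b) (h : DerivTower n F a b) {i : ℕ} (hi : i < n) :
    ContinuousOn (F i) (Icc a b) := by
  simpa [uIcc_of_le hab] using (h.ac i hi).continuousOn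

theorem memLp (hab : a ≤ b) (h : DerivTower n F a b) {i : ℕ} (hi : i ≤ n) :
    MemLp (F i) 2 (volume.restrict (Icc a b)) := by
  rcases hi.lt_or_eq with hi | rfl
  · exact memLp_of_continuousOn_Icc (h.continuousOn hab hi)
  · exact h.memLp_last

theorem mono (h : DerivTower n F a b) (hac : a ≤ c) (hcd : c ≤ d) (hdb : d ≤ b) :
    DerivTower n F c d where
  ac i hi := (h.ac i hi).mono (by
    rw [uIcc_of_le hcd, uIcc_of_le (hac.trans (hcd.trans hdb))]
    exact Icc_subset_Icc hac hdb)
  ae_hasDerivAt i hi := by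
    filter_upwards [h.ae_hasDerivAt i hi] with x hx hx'
    exact hx (Icc_subset_Icc hac hdb hx')
  memLp_last := h.memLp_last.mono_measure
    (Measure.restrict_mono (Icc_subset_Icc hac hdb) le_rfl)

theorem take (hab : a ≤ b) (h : DerivTower n F a b) (hm : m ≤ n) : DerivTower m F a b where
  ac i hi := h.ac i (hi.trans_le hm)
  ae_hasDerivAt i hi := h.ae_hasDerivAt i (hi.trans_le hm)
  memLp_last := h.memLp hab hm

theorem drop (h : DerivTower (m + n) F a b) : DerivTower n (fun i => F (m + i)) a b where
  ac i hi := h.ac _ (by omega)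
  ae_hasDerivAt i hi := h.ae_hasDerivAt (m + i) (by omega)
  memLp_last := h.memLp_last

theorem add (hF : DerivTower n F a b) (hV : DerivTower n V a b) :
    DerivTower n (fun i x => F i x + V i x) a b where
  ac i hi := (hF.ac i hi).add (hV.ac i hi)
  ae_hasDerivAt i hi := by
    filter_upwards [hF.ae_hasDerivAt i hi, hV.ae_hasDerivAt i hi] with x h1 h2 hx
    exact (h1 hx).add (h2 hx)
  memLp_last := hF.memLp_last.add hV.memLp_last

theorem const_mul (hF : DerivTower n F a b) (γ : ℝ) :
    DerivTower n (fun i x => γ * F i x) a b where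
  ac i hi := (hF.ac i hi).const_mul γ
  ae_hasDerivAt i hi := by
    filter_upwards [hF.ae_hasDerivAt i hi] with x h1 hx
    exact (h1 hx).const_mul γ
  memLp_last := hF.memLp_last.const_mul γ

theorem sub (hF : DerivTower n F a b) (hV : DerivTower n V a b) :
    DerivTower n (fun i x => F i x - V i x) a b where
  ac i hi := (hF.ac i hi).sub (hV.ac i hi)
  ae_hasDerivAt i hi := by
    filter_upwards [hF.ae_hasDerivAt i hi, hV.ae_hasDerivAt i hi] with x h1 h2 hx
    exact (h1 hx).sub (h2 hx)
  memLp_last := hF.memLp_last.sub hV.memLp_last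

theorem integral_eq_sub (hab : a ≤ b) (h : DerivTower n F a b) {i : ℕ} (hi : i < n) :
    ∫ x in a..b, F (i + 1) x = F i b - F i a := by
  rw [← (h.ac i hi).integral_deriv_eq_sub]
  apply intervalIntegral.integral_congr_ae
  filter_upwards [h.ae_hasDerivAt i hi] with x hx hx'
  rw [uIoc_of_le hab] at hx'
  exact (hx (Ioc_subset_Icc_self hx')).deriv.symm

theorem integral_mul_succ (hab : a ≤ b) (hV : DerivTower m V a b) (hF : DerivTower n F a b)
    {i j : ℕ} (hi : i < m) (hj : j < n) :
    ∫ x in a..b, V i x * F (j + 1) x =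
      V i b * F j b - V i a * F j a - ∫ x in a..b, V (i + 1) x * F j x := by
  have e1 : ∫ x in a..b, V i x * F (j + 1) x = ∫ x in a..b, V i x * deriv (F j) x := by
    apply intervalIntegral.integral_congr_ae
    filter_upwards [hF.ae_hasDerivAt j hj] with x hx hx'
    rw [uIoc_of_le hab] at hx'
    rw [(hx (Ioc_subset_Icc_self hx')).deriv]
  have e2 : ∫ x in a..b, V (i + 1) x * F j x = ∫ x in a..b, deriv (V i) x * F j x := by
    apply intervalIntegral.integral_congr_ae
    filter_upwards [hV.ae_hasDerivAt i hi] with x hx hx'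
    rw [uIoc_of_le hab] at hx'
    rw [(hx (Ioc_subset_Icc_self hx')).deriv]
  rw [e1, e2, (hV.ac i hi).integral_mul_deriv_eq_deriv_mul (hF.ac j hj)]

/-- Green's formula for the operator of `n`-fold differentiation. -/
theorem green (hab : a ≤ b) (hV : DerivTower n V a b) (hF : DerivTower n F a b) :
    ∫ x in a..b, V 0 x * F n x =
      ∑ s ∈ Finset.range n, (-1) ^ s * (V s b * F (n - 1 - s) b - V s a * F (n - 1 - s) a) +
        (-1) ^ n * ∫ x in a..b, V n x * F 0 x := by
  have key : ∀ j ≤ n, ∫ x in a..b, V 0 x * F n x =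
      ∑ s ∈ Finset.range j, (-1) ^ s * (V s b * F (n - 1 - s) b - V s a * F (n - 1 - s) a) +
        (-1) ^ j * ∫ x in a..b, V j x * F (n - j) x := by
    intro j
    induction j with
    | zero => simp
    | succ j ih =>
      intro hj
      have e : n - j = n - (j + 1) + 1 := by omega
      rw [ih (by omega), e, integral_mul_succ hab hV hF (by omega) (by omega),
        Finset.sum_range_succ, show n - 1 - j = n - (j + 1) by omega]
      ring
  simpa using key n le_rfl

/-- A tower with vanishing last member and vanishing values at one point of the interval is
zero. -/
theorem eq_zero (h : DerivTower n F a b) (h0 : ∀ᵐ x, x ∈ Icc a b → F n x = 0)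
    (hc : c ∈ Icc a b) (hF : ∀ i < n, F i c = 0) (hn : 0 < n) :
    ∀ i < n, ∀ x ∈ Icc a b, F i x = 0 := by
  have step : ∀ i < n, (∀ᵐ x, x ∈ Icc a b → F (i + 1) x = 0) → ∀ x ∈ Icc a b, F i x = 0 := by
    intro i hi hz x hx
    have e := (h.take (m := i + 1) (hc.1.trans hc.2) (by omega))
    have hI : ∀ p q : ℝ, p ∈ Icc a b → q ∈ Icc a b → p ≤ q → F i p = F i q := by
      intro p q hp hq hpq
      have := (e.mono hp.1 hpq hq.2).integral_eq_sub hpq (Nat.lt_succ_self i)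
      rw [intervalIntegral.integral_zero_ae] at this
      · linarith
      · filter_upwards [hz] with y hy hy'
        rw [uIoc_of_le hpq] at hy'
        exact hy ⟨hp.1.trans hy'.1.le, hy'.2.trans hq.2⟩
    rcases le_total x c with hxc | hxc
    · rw [hI x c hx hc hxc, hF i hi]
    · rw [← hI c x hc hx hxc, hF i hi]
  have key : ∀ j < n, ∀ x ∈ Icc a b, F (n - 1 - j) x = 0 := by
    intro j
    induction j with
    | zero =>
      intro _
      refine step _ (by omega) ?_
      rwa [show n - 1 - 0 + 1 = n by omega]
    | succ j ih =>
      intro hj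
      refine step _ (by omega) ?_
      rw [show n - 1 - (j + 1) + 1 = n - 1 - j by omega]
      exact ae_of_all _ (ih (by omega))
  intro i hi
  have := key (n - 1 - i) (by omega)
  rwa [show n - 1 - (n - 1 - i) = i by omega] at this

end DerivTower

/-! ### Towers and Sobolev functions -/

theorem ae_mem_Icc_imp_mem_Ioo (a b : ℝ) : ∀ᵐ x : ℝ, x ∈ Icc a b → x ∈ Ioo a b := by
  have h1 : ∀ᵐ x : ℝ, x ≠ a := by simp [ae_iff]
  have h2 : ∀ᵐ x : ℝ, x ≠ b := by simp [ae_iff]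
  filter_upwards [h1, h2] with x h1 h2 hx
  exact ⟨lt_of_le_of_ne hx.1 h1.symm, lt_of_le_of_ne hx.2 h2⟩

theorem MemSobolev.derivTower {a b : ℝ} {r : ℕ} {f : ℝ → ℝ} (hr : 1 ≤ r) (hab : a < b)
    (hf : MemSobolev a b r f) :
    DerivTower r (fun i => iteratedDerivWithin i f (Icc a b)) a b := by
  have hu : UniqueDiffOn ℝ (Icc a b) := uniqueDiffOn_Icc hab
  have hac : ∀ i < r, AbsolutelyContinuousOnInterval (iteratedDerivWithin i f (Icc a b)) a b := by
    intro i hi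
    rcases (show i ≤ r - 1 by omega).lt_or_eq with h | rfl
    · apply ContDiffOn.absolutelyContinuousOnInterval
      rw [uIcc_of_le hab.le]
      have h1 := (hf.1.of_le (m := ((i + 1 : ℕ) : WithTop ℕ∞)) (by exact_mod_cast h))
      exact ((contDiffOn_nat_succ_iff_contDiffOn_one_iteratedDerivWithin hu).1 h1).2
    · exact hf.2.1
  refine ⟨hac, fun i hi => ?_, hf.2.2⟩
  filter_upwards [(hac i hi).ae_differentiableAt, ae_mem_Icc_imp_mem_Ioo a b] with x hx hx' hxI
  have hd := hx (by rwa [uIcc_of_le hab.le])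
  rw [iteratedDerivWithin_succ,
    derivWithin_of_mem_nhds (Icc_mem_nhds (hx' hxI).1 (hx' hxI).2)]
  exact hd.hasDerivAt

namespace DerivTower

variable {r : ℕ} {F : ℕ → ℝ → ℝ} {a b : ℝ}

/-- Member `i` is a primitive of the continuous member `i + 1`, so the almost everywhere derivative
exists at every point, endpoints included. The last member need not be continuous, hence the
restriction on `i`. -/
theorem hasDerivWithinAt (hab : a ≤ b) (h : DerivTower r F a b) {i : ℕ} (hi : i + 1 < r)
    {x : ℝ} (hx : x ∈ Icc a b) : HasDerivWithinAt (F i) (F (i + 1) x) (Icc a b) x := by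
  have hc := h.continuousOn hab hi
  have hint : IntervalIntegrable (F (i + 1)) volume a x :=
    (hc.mono (Icc_subset_Icc le_rfl hx.2)).intervalIntegrable_of_Icc hx.1
  have : Fact (x ∈ Icc a b) := ⟨hx⟩
  have hd : HasDerivWithinAt (fun y => F i a + ∫ s in a..y, F (i + 1) s) (F (i + 1) x)
      (Icc a b) x :=
    (intervalIntegral.integral_hasDerivWithinAt_right hint
      (hc.stronglyMeasurableAtFilter_nhdsWithin measurableSet_Icc x) (hc x hx)).const_add _
  have he : ∀ y ∈ Icc a b, F i y = F i a + ∫ s in a..y, F (i + 1) s := by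
    intro y hy
    rw [(h.mono le_rfl hy.1 hy.2).integral_eq_sub hy.1 (by omega)]
    ring
  exact hd.congr he (he x hx)

theorem iteratedDerivWithin_eqOn (hab : a < b) (h : DerivTower r F a b) {i : ℕ} (hi : i < r) :
    EqOn (iteratedDerivWithin i (F 0) (Icc a b)) (F i) (Icc a b) := by
  induction i with
  | zero => intro x _; simp
  | succ i ih =>
    intro x hx
    rw [iteratedDerivWithin_succ, derivWithin_congr (ih (by omega)) (ih (by omega) hx)]
    exact (h.hasDerivWithinAt hab.le hi hx).derivWithin (uniqueDiffOn_Icc hab x hx)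

theorem iteratedDerivWithin_last (hr : 1 ≤ r) (hab : a < b) (h : DerivTower r F a b) :
    ∀ᵐ x, x ∈ Icc a b → iteratedDerivWithin r (F 0) (Icc a b) x = F r x := by
  obtain ⟨n, rfl⟩ : ∃ n, r = n + 1 := ⟨r - 1, by omega⟩
  filter_upwards [h.ae_hasDerivAt n (by omega), ae_mem_Icc_imp_mem_Ioo a b] with x hx hx' hxI
  have e := h.iteratedDerivWithin_eqOn hab (Nat.lt_succ_self n)
  rw [iteratedDerivWithin_succ, derivWithin_congr e (e hxI),
    derivWithin_of_mem_nhds (Icc_mem_nhds (hx' hxI).1 (hx' hxI).2)]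
  exact (hx hxI).deriv

theorem memSobolev (hr : 1 ≤ r) (hab : a < b) (h : DerivTower r F a b) :
    MemSobolev a b r (F 0) := by
  have hu : UniqueDiffOn ℝ (Icc a b) := uniqueDiffOn_Icc hab
  refine ⟨?_, ?_, ?_⟩
  · rw [contDiffOn_nat_iff_continuousOn_differentiableOn_deriv hu]
    refine ⟨fun m hm => ?_, fun m hm x hx => ?_⟩
    · have e := h.iteratedDerivWithin_eqOn hab (show m < r by omega)
      exact (h.continuousOn hab.le (by omega)).congr e
    · have e := h.iteratedDerivWithin_eqOn hab (show m < r by omega)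
      exact ((h.hasDerivWithinAt hab.le (by omega) hx).congr e (e hx)).differentiableWithinAt
  · have e := h.iteratedDerivWithin_eqOn hab (show r - 1 < r by omega)
    have hac := h.ac (r - 1) (by omega)
    rw [absolutelyContinuousOnInterval_iff] at hac ⊢
    intro ε hε
    obtain ⟨δ, hδ, H⟩ := hac ε hε
    refine ⟨δ, hδ, fun E hE hs => ?_⟩
    convert H E hE hs using 2 with i hi
    have h1 := hE.1 i hi
    rw [uIcc_of_le hab.le] at h1
    rw [e h1.1, e h1.2]
  · refine (memLp_congr_ae ?_).2 h.memLp_last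
    exact (ae_restrict_iff' measurableSet_Icc).2 (h.iteratedDerivWithin_last hr hab)

end DerivTower

theorem derivTower_of_contDiff {f : ℝ → ℝ} (hf : ContDiff ℝ (⊤ : ℕ∞) f) (n : ℕ) (a b : ℝ) :
    DerivTower n (fun i => iteratedDeriv i f) a b where
  ac i _ := by
    apply ContDiffOn.absolutelyContinuousOnInterval
    rw [iteratedDeriv_eq_iterate]
    exact ((hf.iterate_deriv i).of_le (by exact_mod_cast le_top)).contDiffOn
  ae_hasDerivAt i _ := ae_of_all _ fun x _ => by
    rw [iteratedDeriv_succ]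
    exact ((hf.differentiable_iteratedDeriv i (by exact_mod_cast WithTop.coe_lt_top _)) x).hasDerivAt
  memLp_last := memLp_of_continuousOn_Icc
    (hf.continuous_iteratedDeriv n (by exact_mod_cast le_top)).continuousOn

/-! ### Energy identity and uniqueness for the homogeneous problem -/

theorem ae_eq_zero_of_integral_sq_eq_zero {f : ℝ → ℝ} {a b : ℝ} (hab : a ≤ b)
    (hf : MemLp f 2 (volume.restrict (Icc a b))) (h : ∫ x in a..b, f x * f x = 0) :
    ∀ᵐ x, x ∈ Icc a b → f x = 0 := by
  rw [intervalIntegral.integral_of_le hab, ← integral_Icc_eq_integral_Ioc,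
    integral_eq_zero_iff_of_nonneg (fun x => mul_self_nonneg _) (hf.integrable_mul hf)] at h
  have h' := (ae_restrict_iff' measurableSet_Icc).1 h
  filter_upwards [h'] with x hx hx'
  exact mul_self_eq_zero.1 (hx hx')

/-- The only solution of the homogeneous boundary value problem without jumps is zero. -/
theorem DerivTower.eq_zero_of_bvp {r : ℕ} (hr : 1 ≤ r) {lam : ℝ} (hlam : 0 ≤ lam) {a t b : ℝ}
    (hat : a ≤ t) (htb : t ≤ b) {W Z : ℕ → ℝ → ℝ}
    (hW : DerivTower (2 * r) W a t) (hZ : DerivTower (2 * r) Z t b)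
    (hWa : ∀ s < r, W s a = 0) (hZb : ∀ s < r, Z s b = 0)
    (ht : ∀ s < 2 * r, W s t = Z s t)
    (eW : ∀ᵐ x, x ∈ Icc a t → W (2 * r) x = (-1) ^ (r + 1) * lam * W 0 x)
    (eZ : ∀ᵐ x, x ∈ Icc t b → Z (2 * r) x = (-1) ^ (r + 1) * lam * Z 0 x) :
    (∀ i < r, ∀ x ∈ Icc a t, W i x = 0) ∧ ∀ i < r, ∀ x ∈ Icc t b, Z i x = 0 := by
  have energy : ∀ {p q : ℝ} {V : ℕ → ℝ → ℝ}, p ≤ q → DerivTower (2 * r) V p q →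
      (∀ᵐ x, x ∈ Icc p q → V (2 * r) x = (-1) ^ (r + 1) * lam * V 0 x) →
      (-1) ^ (r + 1) * lam * ∫ x in p..q, V 0 x * V 0 x =
        ∑ s ∈ Finset.range r,
          (-1) ^ s * (V s q * V (2 * r - 1 - s) q - V s p * V (2 * r - 1 - s) p) +
        (-1) ^ r * ∫ x in p..q, V r x * V r x := by
    intro p q V hpq hV eV
    have e1 : ∫ x in p..q, V 0 x * V (r + r) x =
        (-1) ^ (r + 1) * lam * ∫ x in p..q, V 0 x * V 0 x := by
      rw [← intervalIntegral.integral_const_mul]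
      apply intervalIntegral.integral_congr_ae
      filter_upwards [eV] with x hx hx'
      rw [uIoc_of_le hpq] at hx'
      rw [← two_mul, hx (Ioc_subset_Icc_self hx')]
      ring
    rw [two_mul] at hV
    -- Green's formula pairs the lower half of the tower with its upper half, so each boundary
    -- product has a factor of order below `r`, which vanishes at the outer ends.
    rw [← e1, DerivTower.green hpq (hV.take hpq (by omega)) hV.drop]
    congr 1
    refine Finset.sum_congr rfl fun s hs => ?_
    rw [Finset.mem_range] at hs
    rw [show r + (r - 1 - s) = 2 * r - 1 - s by omega]
  have hb : ∑ s ∈ Finset.range r,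
          (-1 : ℝ) ^ s * (W s t * W (2 * r - 1 - s) t - W s a * W (2 * r - 1 - s) a) +
      ∑ s ∈ Finset.range r,
          (-1 : ℝ) ^ s * (Z s b * Z (2 * r - 1 - s) b - Z s t * Z (2 * r - 1 - s) t) = 0 := by
    rw [← Finset.sum_add_distrib]
    refine Finset.sum_eq_zero fun s hs => ?_
    rw [Finset.mem_range] at hs
    rw [hWa s hs, hZb s hs, ht s (by omega), ht (2 * r - 1 - s) (by omega)]
    ring
  have h1 := energy hat hW eW
  have h2 := energy htb hZ eZ
  have hW0 := intervalIntegral.integral_nonneg (μ := volume) hat fun x _ => mul_self_nonneg (W 0 x)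
  have hZ0 := intervalIntegral.integral_nonneg (μ := volume) htb fun x _ => mul_self_nonneg (Z 0 x)
  have hWr := intervalIntegral.integral_nonneg (μ := volume) hat fun x _ => mul_self_nonneg (W r x)
  have hZr := intervalIntegral.integral_nonneg (μ := volume) htb fun x _ => mul_self_nonneg (Z r x)
  have hm1 := mul_nonneg hlam hW0
  have hm2 := mul_nonneg hlam hZ0
  -- With the boundary terms cancelled, the common sign factors out of a sum of four non-negative
  -- terms, so each of them is zero.
  have hs : (-1 : ℝ) ^ r * (lam * (∫ x in a..t, W 0 x * W 0 x) +
      lam * (∫ x in t..b, Z 0 x * Z 0 x) + (∫ x in a..t, W r x * W r x) +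
      ∫ x in t..b, Z r x * Z r x) = 0 := by
    rw [pow_succ] at h1 h2
    linarith
  have hs' := (mul_eq_zero.1 hs).resolve_left (pow_ne_zero _ (by norm_num))
  have hWz := ae_eq_zero_of_integral_sq_eq_zero hat (hW.memLp hat (by omega))
    (show ∫ x in a..t, W r x * W r x = 0 by linarith)
  have hZz := ae_eq_zero_of_integral_sq_eq_zero htb (hZ.memLp htb (by omega))
    (show ∫ x in t..b, Z r x * Z r x = 0 by linarith)
  exact ⟨(hW.take hat (by omega)).eq_zero hWz ⟨le_rfl, hat⟩ hWa hr,
    (hZ.take htb (by omega)).eq_zero hZz ⟨htb, le_rfl⟩ hZb hr⟩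

/-! ### Existence of solutions -/

theorem contDiff_and_iteratedDeriv_eq_of_hasDerivAt {V : ℕ → ℝ → ℝ}
    (h : ∀ i x, HasDerivAt (V i) (V (i + 1) x) x) :
    ContDiff ℝ (⊤ : ℕ∞) (V 0) ∧ ∀ i, iteratedDeriv i (V 0) = V i := by
  have e : ∀ i, iteratedDeriv i (V 0) = V i := by
    intro i
    induction i with
    | zero => simp
    | succ i ih =>
      rw [iteratedDeriv_succ, ih]
      exact funext fun x => (h i x).deriv
  refine ⟨contDiff_of_differentiable_iteratedDeriv fun m _ => ?_, e⟩
  rw [e m]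
  exact fun x => (h m x).differentiableAt

/-- Solutions of `f⁽ⁿ⁾ = c f`, as a linear function of the Cauchy data at `x₀`. -/
theorem exists_cauchy_solution (n : ℕ) (hn : 0 < n) (c x₀ : ℝ) :
    ∃ Φ : (Fin n → ℝ) →ₗ[ℝ] (ℝ → ℝ), ∀ y, ContDiff ℝ (⊤ : ℕ∞) (Φ y) ∧
      (∀ i x, iteratedDeriv (n + i) (Φ y) x = c * iteratedDeriv i (Φ y) x) ∧
      ∀ i : Fin n, iteratedDeriv i (Φ y) x₀ = y i := by
  let o : Fin n := ⟨0, hn⟩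
  -- The companion matrix of the equation; the solution is the first coordinate of exp((x - x₀)A)y.
  let A₀ : (Fin n → ℝ) →ₗ[ℝ] (Fin n → ℝ) :=
    LinearMap.pi fun i => if h : (i : ℕ) + 1 < n then LinearMap.proj ⟨i + 1, h⟩
      else c • LinearMap.proj o
  let A : (Fin n → ℝ) →L[ℝ] (Fin n → ℝ) := LinearMap.toContinuousLinearMap A₀
  have hA1 : ∀ y (i : Fin n) (h : (i : ℕ) + 1 < n), A y i = y ⟨i + 1, h⟩ := by
    intro y i h
    simp [A, A₀, h]
  have hA2 : ∀ y (i : Fin n), ¬ (i : ℕ) + 1 < n → A y i = c * y o := by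
    intro y i h
    simp [A, A₀, h]
  have hpow : ∀ (j : ℕ) (y : Fin n → ℝ) (i : Fin n) (h : (i : ℕ) + j < n),
      (A ^ j) y i = y ⟨i + j, h⟩ := by
    intro j
    induction j with
    | zero => intro y i h; simp
    | succ j ih =>
      intro y i h
      rw [pow_succ', mul_apply_eq_comp, hA1 _ i (by omega), ih _ _ (by simp; omega)]
      congr 2
      simp; omega
  have hpow' : ∀ (j : ℕ) (y : Fin n → ℝ) (h : j < n), (A ^ j) y o = y ⟨j, h⟩ := by
    intro j y h
    rw [hpow j y o (by simpa [o] using h)]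
    simp [o]
  have hn' : ∀ y : Fin n → ℝ, (A ^ n) y o = c * y o := by
    intro y
    obtain ⟨m, rfl⟩ : ∃ m, n = m + 1 := ⟨n - 1, by omega⟩
    rw [pow_succ, mul_apply_eq_comp, hpow' m (A y) (by omega), hA2 _ _ (by simp)]
  let Ex : ℝ → (Fin n → ℝ) →L[ℝ] (Fin n → ℝ) := fun x => NormedSpace.exp ((x - x₀) • A)
  have hEx : ∀ x, HasDerivAt Ex (A * Ex x) x := by
    intro x
    have := (hasDerivAt_exp_smul_const' (𝕂 := ℝ) A (x - x₀)).scomp x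
      ((hasDerivAt_id x).sub_const x₀)
    simpa [Ex, Function.comp_def] using this
  let Φ : (Fin n → ℝ) →ₗ[ℝ] (ℝ → ℝ) :=
    { toFun := fun y x => Ex x y o
      map_add' := fun y z => by ext x; simp
      map_smul' := fun γ y => by ext x; simp }
  refine ⟨Φ, fun y => ?_⟩
  have hV : ∀ i x, HasDerivAt (fun x => (A ^ i) (Ex x y) o) ((A ^ (i + 1)) (Ex x y) o) x := by
    intro i x
    let ℓ : ((Fin n → ℝ) →L[ℝ] (Fin n → ℝ)) →L[ℝ] ℝ :=
      (ContinuousLinearMap.proj o ∘L (A ^ i)) ∘L (ContinuousLinearMap.apply ℝ (Fin n → ℝ) y)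
    have := ℓ.hasFDerivAt.comp_hasDerivAt x (hEx x)
    have h2 : ℓ (A * Ex x) = (A ^ (i + 1)) (Ex x y) o := by
      simp [ℓ, pow_succ]
    rw [← h2]
    exact this
  obtain ⟨h1, h2⟩ := contDiff_and_iteratedDeriv_eq_of_hasDerivAt hV
  have h0 : (fun x => (A ^ 0) (Ex x y) o) = Φ y := by ext x; simp [Φ]
  rw [h0] at h1 h2
  refine ⟨h1, fun i x => ?_, fun i => ?_⟩
  · rw [h2, h2]
    simp only
    rw [pow_add, mul_apply_eq_comp, hn']
  · rw [h2]
    simp only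
    rw [hpow' i _ i.2]
    simp [Ex]

/-- `L` on the left of `t` and `L + G` on the right of `t` solve the boundary value problem. -/
structure IsKernel (r k : ℕ) (t lam : ℝ) (L G : ℝ → ℝ) : Prop where
  smooth_left : ContDiff ℝ (⊤ : ℕ∞) L
  smooth_jump : ContDiff ℝ (⊤ : ℕ∞) G
  ode_left : ∀ i x, iteratedDeriv (2 * r + i) L x = (-1) ^ (r + 1) * lam * iteratedDeriv i L x
  ode_jump : ∀ i x, iteratedDeriv (2 * r + i) G x = (-1) ^ (r + 1) * lam * iteratedDeriv i G x
  left_end : ∀ s < r, iteratedDeriv s L (-1) = 0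
  right_end : ∀ s < r, iteratedDeriv s L 1 + iteratedDeriv s G 1 = 0
  jump : ∀ s < 2 * r, iteratedDeriv s G t = if s = r - k - 1 then (-1) ^ (k + 1) else 0

theorem iteratedDeriv_add_of_contDiff {f g : ℝ → ℝ} (hf : ContDiff ℝ (⊤ : ℕ∞) f)
    (hg : ContDiff ℝ (⊤ : ℕ∞) g) (i : ℕ) (x : ℝ) :
    iteratedDeriv i (f + g) x = iteratedDeriv i f x + iteratedDeriv i g x :=
  iteratedDeriv_add ((hf.of_le (by exact_mod_cast le_top)).contDiffAt)
    ((hg.of_le (by exact_mod_cast le_top)).contDiffAt)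

/-- `G` carries the prescribed jump as Cauchy data at `t`. It remains to choose `L` with given
Dirichlet data at both ends: a linear map between spaces of dimension 2r, injective by the energy
identity and therefore surjective. -/
theorem exists_isKernel {r k : ℕ} (hr : 1 ≤ r) (t : ℝ) {lam : ℝ} (hlam : 0 ≤ lam) :
    ∃ L G, IsKernel r k t lam L G := by
  obtain ⟨Ψ, hΨ⟩ := exists_cauchy_solution (2 * r) (by omega) ((-1) ^ (r + 1) * lam) t
  obtain ⟨Φ, hΦ⟩ := exists_cauchy_solution (2 * r) (by omega) ((-1) ^ (r + 1) * lam) (-1)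
  let G := Ψ fun s => if (s : ℕ) = r - k - 1 then (-1) ^ (k + 1) else 0
  let T : (Fin (2 * r) → ℝ) →ₗ[ℝ] (Fin r ⊕ Fin r → ℝ) :=
    { toFun := fun y => Sum.elim (fun s => iteratedDeriv s (Φ y) (-1))
        (fun s => iteratedDeriv s (Φ y) 1)
      map_add' := fun y z => by
        ext s
        rcases s with s | s <;>
          simp [iteratedDeriv_add_of_contDiff (hΦ y).1 (hΦ z).1]
      map_smul' := fun γ y => by
        ext s
        rcases s with s | s <;> simp }
  have hTi : Function.Injective T := by
    rw [injective_iff_map_eq_zero]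
    intro y hy
    have h1 : ∀ s < r, iteratedDeriv s (Φ y) (-1) = 0 := fun s hs => by
      simpa [T] using congrFun hy (Sum.inl ⟨s, hs⟩)
    have h2 : ∀ s < r, iteratedDeriv s (Φ y) 1 = 0 := fun s hs => by
      simpa [T] using congrFun hy (Sum.inr ⟨s, hs⟩)
    have hz := (DerivTower.eq_zero_of_bvp hr hlam (a := -1) (t := 0) (b := 1) (by norm_num)
      (by norm_num) (derivTower_of_contDiff (hΦ y).1 (2 * r) (-1) 0)
      (derivTower_of_contDiff (hΦ y).1 (2 * r) 0 1) h1 h2 (fun _ _ => rfl)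
      (ae_of_all _ fun x _ => (hΦ y).2.1 0 x) (ae_of_all _ fun x _ => (hΦ y).2.1 0 x)).1
    have hz0 : ∀ x ∈ Icc (-1 : ℝ) 0, Φ y x = 0 := by simpa using hz 0 hr
    -- The energy argument controls only orders below `r`; the remaining Cauchy data at -1 are
    -- reached by continuity from the open interval.
    have hev : ∀ i, ∀ x ∈ Ioo (-1 : ℝ) 0, iteratedDeriv i (Φ y) x = 0 := by
      intro i x hx
      have : Φ y =ᶠ[𝓝 x] fun _ => 0 := by
        filter_upwards [Ioo_mem_nhds hx.1 hx.2] with z hz'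
        exact hz0 z ⟨hz'.1.le, hz'.2.le⟩
      rw [(this.iteratedDeriv i).eq_of_nhds]
      simp
    ext i
    rw [← (hΦ y).2.2 i]
    have hcont : Continuous (iteratedDeriv i (Φ y)) :=
      (hΦ y).1.continuous_iteratedDeriv _ (by exact_mod_cast le_top)
    have hcl : IsClosed {x | iteratedDeriv i (Φ y) x = 0} := isClosed_eq hcont continuous_const
    have hsub : closure (Ioo (-1 : ℝ) 0) ⊆ {x | iteratedDeriv i (Φ y) x = 0} :=
      hcl.closure_subset_iff.2 fun x hx => hev i x hx
    rw [closure_Ioo (by norm_num)] at hsub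
    exact hsub ⟨le_rfl, by norm_num⟩
  have hTs : Function.Surjective T :=
    (LinearMap.injective_iff_surjective_of_finrank_eq_finrank (by simp [two_mul])).1 hTi
  obtain ⟨y, hy⟩ := hTs (Sum.elim (fun _ => 0) fun s => -iteratedDeriv s G 1)
  refine ⟨Φ y, G, (hΦ y).1, (hΨ _).1, (hΦ y).2.1, (hΨ _).2.1, fun s hs => ?_, fun s hs => ?_,
    fun s hs => (hΨ _).2.2 ⟨s, hs⟩⟩
  · simpa [T] using congrFun hy (Sum.inl ⟨s, hs⟩)
  · have := congrFun hy (Sum.inr ⟨s, hs⟩)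
    simp only [T, LinearMap.coe_mk, AddHom.coe_mk, Sum.elim_inr] at this
    rw [this]
    ring

/-! ### The glued solution -/

/-- The `i`-th derivative of the function which is `L` on the left of `t` and `L + G` on the right
of `t`. -/
noncomputable def glueDeriv (t : ℝ) (L G : ℝ → ℝ) (i : ℕ) (x : ℝ) : ℝ :=
  iteratedDeriv i L x + if t < x then iteratedDeriv i G x else 0

theorem glueDeriv_of_le {t x : ℝ} (L G : ℝ → ℝ) (i : ℕ) (hx : x ≤ t) :
    glueDeriv t L G i x = iteratedDeriv i L x := by
  simp [glueDeriv, not_lt.2 hx]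

theorem glueDeriv_of_lt {t x : ℝ} (L G : ℝ → ℝ) (i : ℕ) (hx : t < x) :
    glueDeriv t L G i x = iteratedDeriv i L x + iteratedDeriv i G x := by
  simp [glueDeriv, hx]

namespace IsKernel

variable {r k : ℕ} {t lam : ℝ} {L G : ℝ → ℝ}

theorem eventuallyEq_left {x : ℝ} (L G : ℝ → ℝ) (hx : x < t) : glueDeriv t L G 0 =ᶠ[𝓝 x] L := by
  filter_upwards [Iio_mem_nhds hx] with y hy
  simp [glueDeriv_of_le L G 0 hy.le]

theorem eventuallyEq_right {x : ℝ} (L G : ℝ → ℝ) (hx : t < x) :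
    glueDeriv t L G 0 =ᶠ[𝓝 x] L + G := by
  filter_upwards [Ioi_mem_nhds hx] with y hy
  simp [glueDeriv_of_lt L G 0 hy]

theorem iteratedDeriv_glueDeriv (h : IsKernel r k t lam L G) {x : ℝ} (hx : x ≠ t) (i : ℕ) :
    iteratedDeriv i (glueDeriv t L G 0) x = glueDeriv t L G i x := by
  rcases hx.lt_or_gt with hx | hx
  · rw [((eventuallyEq_left L G hx).iteratedDeriv i).eq_of_nhds, glueDeriv_of_le L G i hx.le]
  · rw [((eventuallyEq_right L G hx).iteratedDeriv i).eq_of_nhds, glueDeriv_of_lt L G i hx,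
      iteratedDeriv_add_of_contDiff h.smooth_left h.smooth_jump]

theorem glueDeriv_ode (h : IsKernel r k t lam L G) (i : ℕ) (x : ℝ) :
    glueDeriv t L G (2 * r + i) x = (-1) ^ (r + 1) * lam * glueDeriv t L G i x := by
  unfold glueDeriv
  rw [h.ode_left, h.ode_jump]
  split_ifs <;> ring

theorem tendsto_left (h : IsKernel r k t lam L G) {l : Filter ℝ} {x : ℝ} (hl : l ≤ 𝓝 x)
    (hlt : ∀ᶠ y in l, y < t) (i : ℕ) :
    Tendsto (iteratedDeriv i (glueDeriv t L G 0)) l (𝓝 (iteratedDeriv i L x)) := by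
  have hc := (h.smooth_left.continuous_iteratedDeriv i (by exact_mod_cast le_top)).tendsto x
  refine (hc.mono_left hl).congr' ?_
  filter_upwards [hlt] with y hy
  rw [h.iteratedDeriv_glueDeriv hy.ne, glueDeriv_of_le L G i hy.le]

theorem tendsto_right (h : IsKernel r k t lam L G) {l : Filter ℝ} {x : ℝ} (hl : l ≤ 𝓝 x)
    (hlt : ∀ᶠ y in l, t < y) (i : ℕ) :
    Tendsto (iteratedDeriv i (glueDeriv t L G 0)) l
      (𝓝 (iteratedDeriv i L x + iteratedDeriv i G x)) := by
  have hc := ((h.smooth_left.continuous_iteratedDeriv i (by exact_mod_cast le_top)).add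
    (h.smooth_jump.continuous_iteratedDeriv i (by exact_mod_cast le_top))).tendsto x
  refine (hc.mono_left hl).congr' ?_
  filter_upwards [hlt] with y hy
  rw [h.iteratedDeriv_glueDeriv hy.ne', glueDeriv_of_lt L G i hy]
  rfl

theorem isSolution (h : IsKernel r k t lam L G) (hr : 1 ≤ r) (ht : t ∈ Ioo (-1 : ℝ) 1) :
    IsSolution r k t lam (glueDeriv t L G 0) where
  mem_left := ⟨L, by
    simpa using (derivTower_of_contDiff h.smooth_left (2 * r) (-1) t).memSobolev (by omega) ht.1,
    fun x hx => by simp [glueDeriv_of_le L G 0 hx.2.le]⟩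
  mem_right := ⟨L + G, by
    have := (derivTower_of_contDiff (f := L + G) (h.smooth_left.add h.smooth_jump) (2 * r) t
      1).memSobolev (by omega) ht.2
    rwa [iteratedDeriv_zero] at this,
    fun x hx => by simp [glueDeriv_of_lt L G 0 hx.1]⟩
  equation x hx := by
    have hxt : x ≠ t := by
      rcases hx with hx | hx
      · exact hx.2.ne
      · exact hx.1.ne'
    rw [h.iteratedDeriv_glueDeriv hxt]
    have := h.glueDeriv_ode 0 x
    rw [add_zero] at this
    rw [this, pow_succ]
    have e : (-1 : ℝ) ^ r * (-1) ^ r = 1 := by rw [← mul_pow]; simp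
    linear_combination (-lam * glueDeriv t L G 0 x) * e
  left_end s hs := by
    rw [← h.left_end s hs]
    exact h.tendsto_left nhdsWithin_le_nhds
      (mem_nhdsWithin_of_mem_nhds (Iio_mem_nhds ht.1)) s
  right_end s hs := by
    rw [← h.right_end s hs]
    exact h.tendsto_right nhdsWithin_le_nhds
      (mem_nhdsWithin_of_mem_nhds (Ioi_mem_nhds ht.2)) s
  jump s hs := ⟨_, _, h.tendsto_right nhdsWithin_le_nhds self_mem_nhdsWithin s,
    h.tendsto_left nhdsWithin_le_nhds self_mem_nhdsWithin s, by
      rw [add_sub_cancel_left, h.jump s hs]⟩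

end IsKernel

/-! ### Uniqueness of the solution -/

/-- Continuity of the extension identifies one-sided limits. -/
theorem MemSobolevIoo.exists_tower {a b : ℝ} {n : ℕ} {u : ℝ → ℝ} (hn : 1 ≤ n) (hab : a < b)
    (h : MemSobolevIoo a b n u) :
    ∃ F : ℕ → ℝ → ℝ, DerivTower n F a b ∧ (∀ i, ∀ x ∈ Ioo a b, iteratedDeriv i u x = F i x) ∧
      (∀ i < n, Tendsto (iteratedDeriv i u) (𝓝[>] a) (𝓝 (F i a))) ∧
      ∀ i < n, Tendsto (iteratedDeriv i u) (𝓝[<] b) (𝓝 (F i b)) := by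
  obtain ⟨g, hg, he⟩ := h
  have hT := hg.derivTower hn hab
  have hE : ∀ i, ∀ x ∈ Ioo a b, iteratedDeriv i u x = iteratedDerivWithin i g (Icc a b) x := by
    intro i x hx
    have h1 : iteratedDerivWithin i u (Ioo a b) x = iteratedDeriv i u x :=
      iteratedDerivWithin_of_isOpen isOpen_Ioo hx
    rw [← h1, iteratedDerivWithin_congr he hx]
    simp only [iteratedDerivWithin]
    rw [iteratedFDerivWithin_congr_set (s := Ioo a b) (t := Icc a b)]
    filter_upwards [isOpen_Ioo.mem_nhds hx] with y hy
    exact propext ⟨fun h => Ioo_subset_Icc_self h, fun _ => hy⟩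
  refine ⟨_, hT, hE, fun i hi => ?_, fun i hi => ?_⟩
  · have hc := (hT.continuousOn hab.le hi) a ⟨le_rfl, hab.le⟩
    have hc' := hc.mono_left (nhdsWithin_mono a Ioo_subset_Icc_self)
    rw [nhdsWithin_Ioo_eq_nhdsGT hab] at hc'
    refine hc'.congr' ?_
    filter_upwards [Ioo_mem_nhdsGT hab] with x hx
    exact (hE i x hx).symm
  · have hc := (hT.continuousOn hab.le hi) b ⟨hab.le, le_rfl⟩
    have hc' := hc.mono_left (nhdsWithin_mono b Ioo_subset_Icc_self)
    rw [nhdsWithin_Ioo_eq_nhdsLT hab] at hc'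
    refine hc'.congr' ?_
    filter_upwards [Ioo_mem_nhdsLT hab] with x hx
    exact (hE i x hx).symm

theorem IsSolution.eqOn {r k : ℕ} {t lam : ℝ} {u v : ℝ → ℝ} (hr : 1 ≤ r)
    (ht : t ∈ Ioo (-1 : ℝ) 1) (hlam : 0 ≤ lam) (hv : IsSolution r k t lam v)
    (hu : IsSolution r k t lam u) : EqOn v u (Ioo (-1) t ∪ Ioo t 1) := by
  obtain ⟨V, hV, eV, lV, rV⟩ := hv.mem_left.exists_tower (by omega) ht.1
  obtain ⟨V', hV', eV', lV', rV'⟩ := hv.mem_right.exists_tower (by omega) ht.2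
  obtain ⟨U, hU, eU, lU, rU⟩ := hu.mem_left.exists_tower (by omega) ht.1
  obtain ⟨U', hU', eU', lU', rU'⟩ := hu.mem_right.exists_tower (by omega) ht.2
  have sgn : (-1 : ℝ) ^ r * (-1) ^ r = 1 := by rw [← mul_pow]; simp
  have ode : ∀ {w : ℝ → ℝ} {x : ℝ}, IsSolution r k t lam w → x ∈ Ioo (-1) t ∪ Ioo t 1 →
      iteratedDeriv (2 * r) w x = (-1) ^ (r + 1) * lam * w x := by
    intro w x hw hx
    have := hw.equation x hx
    rw [pow_succ]
    linear_combination (-1 : ℝ) ^ r * this - iteratedDeriv (2 * r) w x * sgn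
  have key := DerivTower.eq_zero_of_bvp hr hlam ht.1.le ht.2.le (hV.sub hU) (hV'.sub hU')
    (fun s hs => by
      rw [tendsto_nhds_unique (lV s (by omega)) (hv.left_end s hs),
        tendsto_nhds_unique (lU s (by omega)) (hu.left_end s hs), sub_zero])
    (fun s hs => by
      rw [tendsto_nhds_unique (rV' s (by omega)) (hv.right_end s hs),
        tendsto_nhds_unique (rU' s (by omega)) (hu.right_end s hs), sub_zero])
    (fun s hs => by
      obtain ⟨p, m, hp, hm, e⟩ := hv.jump s hs
      obtain ⟨p', m', hp', hm', e'⟩ := hu.jump s hs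
      rw [tendsto_nhds_unique (lV' s hs) hp, tendsto_nhds_unique (rV s hs) hm,
        tendsto_nhds_unique (lU' s hs) hp', tendsto_nhds_unique (rU s hs) hm']
      linarith)
    (by
      filter_upwards [ae_mem_Icc_imp_mem_Ioo (-1) t] with x hx hx'
      have hx := hx hx'
      rw [← eV _ x hx, ← eU _ x hx, ode hv (Or.inl hx), ode hu (Or.inl hx), ← eV 0 x hx,
        ← eU 0 x hx, iteratedDeriv_zero, iteratedDeriv_zero]
      ring)
    (by
      filter_upwards [ae_mem_Icc_imp_mem_Ioo t 1] with x hx hx'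
      have hx := hx hx'
      rw [← eV' _ x hx, ← eU' _ x hx, ode hv (Or.inr hx), ode hu (Or.inr hx), ← eV' 0 x hx,
        ← eU' 0 x hx, iteratedDeriv_zero, iteratedDeriv_zero]
      ring)
  rintro x (hx | hx)
  · have h1 := key.1 0 hr x (Ioo_subset_Icc_self hx)
    rw [← eV 0 x hx, ← eU 0 x hx, iteratedDeriv_zero, iteratedDeriv_zero] at h1
    linarith
  · have h1 := key.2 0 hr x (Ioo_subset_Icc_self hx)
    rw [← eV' 0 x hx, ← eU' 0 x hx, iteratedDeriv_zero, iteratedDeriv_zero] at h1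
    linarith

/-! ### The representation formula -/

namespace IsKernel

variable {r k : ℕ} {t lam : ℝ} {L G : ℝ → ℝ}

theorem memLp_glueDeriv (h : IsKernel r k t lam L G) (i : ℕ) (a b : ℝ) :
    MemLp (glueDeriv t L G i) 2 (volume.restrict (Icc a b)) := by
  have h1 := (derivTower_of_contDiff h.smooth_left i a b).memLp_last
  have h2 := (derivTower_of_contDiff h.smooth_jump i a b).memLp_last
  convert h1.add (h2.indicator (measurableSet_Ioi (a := t))) using 1
  ext x
  simp [glueDeriv, indicator_apply]

theorem hasDerivAt_glueDeriv (h : IsKernel r k t lam L G) (i : ℕ) {x : ℝ} (hx : x ≠ t) :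
    HasDerivAt (glueDeriv t L G i) (glueDeriv t L G (i + 1) x) x := by
  have hd : ∀ {f : ℝ → ℝ}, ContDiff ℝ (⊤ : ℕ∞) f →
      HasDerivAt (iteratedDeriv i f) (iteratedDeriv (i + 1) f x) x := by
    intro f hf
    rw [iteratedDeriv_succ]
    exact ((hf.differentiable_iteratedDeriv i
      (by exact_mod_cast WithTop.coe_lt_top _)) x).hasDerivAt
  rcases hx.lt_or_gt with hx | hx
  · rw [glueDeriv_of_le L G _ hx.le]
    refine (hd h.smooth_left).congr_of_eventuallyEq ?_
    filter_upwards [Iio_mem_nhds hx] with y hy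
    exact glueDeriv_of_le L G i hy.le
  · rw [glueDeriv_of_lt L G _ hx]
    refine ((hd h.smooth_left).add (hd h.smooth_jump)).congr_of_eventuallyEq ?_
    filter_upwards [Ioi_mem_nhds hx] with y hy
    exact glueDeriv_of_lt L G i hy

/-- The derivatives of orders `r, …, 2 r` of the solution have no jumps. -/
theorem derivTower (h : IsKernel r k t lam L G) (hr : 1 ≤ r) (ht : t ∈ Ioo (-1 : ℝ) 1) :
    DerivTower r (fun i => glueDeriv t L G (r + i)) (-1) 1 where
  ac i hi := by
    have hG : iteratedDeriv (r + i) G t = 0 := by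
      rw [h.jump (r + i) (by omega), if_neg (by omega)]
    -- Because the jump part vanishes at `t`, the cut-off can be moved into the argument as `max x
    -- t`, which makes the function visibly Lipschitz.
    have e : glueDeriv t L G (r + i) =
        fun x => iteratedDeriv (r + i) L x + iteratedDeriv (r + i) G (max x t) := by
      ext x
      rcases le_or_gt x t with hx | hx
      · rw [glueDeriv_of_le L G _ hx, max_eq_right hx, hG, add_zero]
      · rw [glueDeriv_of_lt L G _ hx, max_eq_left hx.le]
    simp only [e]
    refine ((derivTower_of_contDiff h.smooth_left (r + i + 1) (-1) 1).ac (r + i) (by omega)).add ?_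
    have hc : ContDiffOn ℝ 1 (iteratedDeriv (r + i) G) (Icc (-1) 1) := by
      rw [iteratedDeriv_eq_iterate]
      exact ((h.smooth_jump.iterate_deriv _).of_le (by exact_mod_cast le_top)).contDiffOn
    obtain ⟨K, hK⟩ := hc.exists_lipschitzOnWith (by decide) (convex_Icc _ _) isCompact_Icc
    have hmax : LipschitzOnWith 1 (fun x : ℝ => max x t) (Icc (-1) 1) :=
      (LipschitzWith.id.max_const t).lipschitzOnWith
    have hcomp := hK.comp hmax (fun x hx => ⟨le_max_of_le_left hx.1, max_le hx.2 ht.2.le⟩)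
    apply LipschitzOnWith.absolutelyContinuousOnInterval (K := K * 1)
    rw [uIcc_of_le (by norm_num)]
    exact hcomp
  ae_hasDerivAt i _ := by
    have h1 : ∀ᵐ x : ℝ, x ≠ t := by simp [ae_iff]
    filter_upwards [h1] with x hx _
    exact h.hasDerivAt_glueDeriv _ hx
  memLp_last := h.memLp_glueDeriv _ _ _

/-- Green's formula on each side of `t`: the end conditions remove the terms at ±1, and at `t` only
the jump of order r-k-1 survives, paired with `F k`. -/
theorem represents (h : IsKernel r k t lam L G) (hk : k < r) (ht : t ∈ Ioo (-1 : ℝ) 1)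
    {F : ℕ → ℝ → ℝ} (hF : DerivTower r F (-1) 1) :
    F k t = (-1) ^ (r + 1) * (∫ x in (-1 : ℝ)..1, glueDeriv t L G 0 x * F r x) +
      ∫ x in (-1 : ℝ)..1, glueDeriv t L G r x * F 0 x := by
  have hF1 := hF.mono le_rfl ht.1.le ht.2.le
  have hF2 := hF.mono ht.1.le ht.2.le le_rfl
  have hL := derivTower_of_contDiff h.smooth_left r (-1) t
  have hR := (derivTower_of_contDiff h.smooth_left r t 1).add
    (derivTower_of_contDiff h.smooth_jump r t 1)
  have split : ∀ i j, i ≤ r → j ≤ r → ∫ x in (-1 : ℝ)..1, glueDeriv t L G i x * F j x =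
      (∫ x in (-1 : ℝ)..t, iteratedDeriv i L x * F j x) +
        ∫ x in t..1, (iteratedDeriv i L x + iteratedDeriv i G x) * F j x := by
    intro i j hi hj
    rw [← intervalIntegral.integral_add_adjacent_intervals
      (intervalIntegrable_mul_of_memLp ht.1.le (h.memLp_glueDeriv i _ _) (hF1.memLp ht.1.le hj))
      (intervalIntegrable_mul_of_memLp ht.2.le (h.memLp_glueDeriv i _ _) (hF2.memLp ht.2.le hj))]
    congr 1
    · apply intervalIntegral.integral_congr_ae
      refine ae_of_all _ fun x hx => ?_
      rw [uIoc_of_le ht.1.le] at hx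
      rw [glueDeriv_of_le L G i hx.2]
    · apply intervalIntegral.integral_congr_ae
      refine ae_of_all _ fun x hx => ?_
      rw [uIoc_of_le ht.2.le] at hx
      rw [glueDeriv_of_lt L G i hx.1]
  have hb : ∑ s ∈ Finset.range r, (-1 : ℝ) ^ s *
        (iteratedDeriv s L t * F (r - 1 - s) t - iteratedDeriv s L (-1) * F (r - 1 - s) (-1)) +
      ∑ s ∈ Finset.range r, (-1 : ℝ) ^ s *
        ((iteratedDeriv s L 1 + iteratedDeriv s G 1) * F (r - 1 - s) 1 -
          (iteratedDeriv s L t + iteratedDeriv s G t) * F (r - 1 - s) t) =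
      (-1) ^ (r + 1) * F k t := by
    rw [← Finset.sum_add_distrib, Finset.sum_eq_single (r - k - 1)]
    · rw [h.left_end _ (by omega), h.right_end _ (by omega), h.jump _ (by omega), if_pos rfl,
        show r - 1 - (r - k - 1) = k by omega]
      obtain ⟨m, rfl⟩ : ∃ m, r = m + k + 1 := ⟨r - k - 1, by omega⟩
      rw [show m + k + 1 - k - 1 = m by omega]
      ring
    · intro s hs hne
      rw [Finset.mem_range] at hs
      rw [h.left_end _ hs, h.right_end _ hs, h.jump _ (by omega), if_neg hne]
      ring
    · intro hn
      exact absurd (Finset.mem_range.2 (by omega)) hn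
  rw [split 0 r (by omega) le_rfl, split r 0 le_rfl (by omega)]
  have g1 := DerivTower.green ht.1.le hL hF1
  have g2 := DerivTower.green ht.2.le hR hF2
  have sgn : (-1 : ℝ) ^ r * (-1) ^ r = 1 := by rw [← mul_pow]; simp
  rw [g1, g2]
  rw [pow_succ] at hb ⊢
  linear_combination (-1 : ℝ) ^ r * hb - (F k t - (∫ x in (-1 : ℝ)..t, iteratedDeriv r L x * F 0 x)
    - ∫ x in t..1, (iteratedDeriv r L x + iteratedDeriv r G x) * F 0 x) * sgn

end IsKernel

/-! ### Cauchy–Schwarz and the norm -/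

theorem abs_integral_mul_le {f g : ℝ → ℝ} {a b : ℝ} (hab : a ≤ b)
    (hf : MemLp f 2 (volume.restrict (Icc a b))) (hg : MemLp g 2 (volume.restrict (Icc a b))) :
    |∫ x in a..b, f x * g x| ≤
      Real.sqrt (∫ x in a..b, f x * f x) * Real.sqrt (∫ x in a..b, g x * g x) := by
  have hff := intervalIntegrable_mul_of_memLp hab hf hf
  have hfg := intervalIntegrable_mul_of_memLp hab hf hg
  have hgg := intervalIntegrable_mul_of_memLp hab hg hg
  have key : ∀ s : ℝ, 0 ≤ (∫ x in a..b, g x * g x) * (s * s) +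
      (2 * ∫ x in a..b, f x * g x) * s + ∫ x in a..b, f x * f x := by
    intro s
    have e : (∫ x in a..b, g x * g x) * (s * s) +
        (2 * ∫ x in a..b, f x * g x) * s + ∫ x in a..b, f x * f x =
        ∫ x in a..b, (f x + s * g x) * (f x + s * g x) := by
      have : ∀ x, (f x + s * g x) * (f x + s * g x) =
          (s * s) * (g x * g x) + (2 * s) * (f x * g x) + f x * f x := fun x => by ring
      simp only [this]
      rw [intervalIntegral.integral_add ((hgg.const_mul _).add (hfg.const_mul _)) hff,
        intervalIntegral.integral_add (hgg.const_mul _) (hfg.const_mul _),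
        intervalIntegral.integral_const_mul, intervalIntegral.integral_const_mul]
      ring
    rw [e]
    exact intervalIntegral.integral_nonneg hab fun x _ => mul_self_nonneg _
  have hd := discrim_le_zero key
  rw [discrim] at hd
  have hF0 := intervalIntegral.integral_nonneg (μ := volume) hab fun x _ => mul_self_nonneg (f x)
  rw [← Real.sqrt_mul hF0]
  apply Real.abs_le_sqrt
  nlinarith

theorem l2norm_eq_sqrt (g : ℝ → ℝ) :
    l2norm g = Real.sqrt (∫ x in (-1 : ℝ)..1, g x * g x) := by
  simp [l2norm, sq]

theorem l2norm_nonneg (g : ℝ → ℝ) : 0 ≤ l2norm g := Real.sqrt_nonneg _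

theorem l2norm_sq (g : ℝ → ℝ) : l2norm g ^ 2 = ∫ x in (-1 : ℝ)..1, g x * g x := by
  rw [l2norm_eq_sqrt, Real.sq_sqrt]
  exact intervalIntegral.integral_nonneg (by norm_num) fun x _ => mul_self_nonneg _

theorem l2norm_congr_ae {f g : ℝ → ℝ} (h : ∀ᵐ x, x ∈ Icc (-1 : ℝ) 1 → f x = g x) :
    l2norm f = l2norm g := by
  unfold l2norm
  congr 1
  apply intervalIntegral.integral_congr_ae
  filter_upwards [h] with x hx hx'
  rw [uIoc_of_le (by norm_num)] at hx'
  rw [hx (Ioc_subset_Icc_self hx')]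

theorem l2norm_const_mul (γ : ℝ) (g : ℝ → ℝ) : l2norm (fun x => γ * g x) = |γ| * l2norm g := by
  rw [l2norm_eq_sqrt, l2norm_eq_sqrt, ← Real.sqrt_sq_eq_abs, ← Real.sqrt_mul (sq_nonneg γ),
    ← intervalIntegral.integral_const_mul]
  congr 2
  ext x
  ring

theorem abs_integral_mul_le_l2norm {f g : ℝ → ℝ}
    (hf : MemLp f 2 (volume.restrict (Icc (-1 : ℝ) 1)))
    (hg : MemLp g 2 (volume.restrict (Icc (-1 : ℝ) 1))) :
    |∫ x in (-1 : ℝ)..1, f x * g x| ≤ l2norm f * l2norm g := by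
  rw [l2norm_eq_sqrt, l2norm_eq_sqrt]
  exact abs_integral_mul_le (by norm_num) hf hg

theorem sqrt_integral_le_l2norm {f : ℝ → ℝ} {c d : ℝ} (hc : -1 ≤ c) (hcd : c ≤ d) (hd : d ≤ 1)
    (hf : MemLp f 2 (volume.restrict (Icc (-1 : ℝ) 1))) :
    Real.sqrt (∫ x in c..d, f x * f x) ≤ l2norm f := by
  rw [l2norm_eq_sqrt]
  apply Real.sqrt_le_sqrt
  exact intervalIntegral.integral_mono_interval hc hcd hd
    (ae_of_all _ fun x => mul_self_nonneg _)
    (intervalIntegrable_mul_of_memLp (by norm_num) hf hf)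

/-! ### Test functions and auxiliary inequalities -/

open Polynomial in
theorem derivTower_of_polynomial (P : ℝ[X]) (t : ℝ) (n : ℕ) (a b : ℝ) :
    DerivTower n (fun i x => (derivative^[i] P).eval (x - t)) a b := by
  have h : ∀ (i : ℕ) (x : ℝ), HasDerivAt (fun x => (derivative^[i] P).eval (x - t))
      ((derivative^[i + 1] P).eval (x - t)) x := by
    intro i x
    rw [Function.iterate_succ_apply']
    simpa [Function.comp_def] using ((derivative^[i] P).hasDerivAt (x - t)).comp x
      ((hasDerivAt_id x).sub_const t)
  obtain ⟨h1, h2⟩ := contDiff_and_iteratedDeriv_eq_of_hasDerivAt h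
  have := derivTower_of_contDiff h1 n a b
  simpa only [h2] using this

open Polynomial in
theorem eval_zero_iterate_derivative (P : ℝ[X]) (k : ℕ) :
    (derivative^[k] P).eval 0 = k.factorial * P.coeff k := by
  rw [← coeff_zero_eq_eval_zero, coeff_iterate_derivative]
  simp [Nat.descFactorial_self]

open Polynomial in
/-- Evaluation of the `k`-th derivative at `t` is not bounded in the norm of `L_2`. -/
theorem exists_tower_mul_l2norm_lt {t : ℝ} (ht : t ∈ Ioo (-1 : ℝ) 1) (r k : ℕ) (M : ℝ) :
    ∃ F : ℕ → ℝ → ℝ, DerivTower r F (-1) 1 ∧ M * l2norm (F 0) < F k t := by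
  -- In x - t the second factor has modulus below 1 off `t`, since |x - t| < 2 on (-1, 1]. So the
  -- norms tend to 0 while the `k`-th derivative at `t` stays k!.
  let P : ℕ → ℝ[X] := fun n => X ^ k * (1 - C (1 / 4) * X ^ 2) ^ n
  let F : ℕ → ℕ → ℝ → ℝ := fun n i x => (derivative^[i] (P n)).eval (x - t)
  have hFk : ∀ n, F n k t = k.factorial := by
    intro n
    simp only [F, sub_self]
    rw [eval_zero_iterate_derivative, show P n = (1 - C (1 / 4) * X ^ 2) ^ n * X ^ k from mul_comm _ _,
      coeff_mul_X_pow', if_pos le_rfl,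
      Nat.sub_self, coeff_zero_eq_eval_zero]
    simp
  have hF0 : ∀ n x, F n 0 x = (x - t) ^ k * (1 - 1 / 4 * (x - t) ^ 2) ^ n := by
    intro n x
    simp [F, P]
  have hlim : Tendsto (fun n => ∫ x in (-1 : ℝ)..1, F n 0 x * F n 0 x) atTop (𝓝 0) := by
    have : (0 : ℝ) = ∫ x in (-1 : ℝ)..1, (0 : ℝ) := by simp
    rw [this]
    apply intervalIntegral.tendsto_integral_filter_of_dominated_convergence
      (fun _ => (2 : ℝ) ^ k * 2 ^ k)
    · refine Eventually.of_forall fun n => ?_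
      have : Continuous fun x => F n 0 x * F n 0 x := by
        simp only [hF0]
        fun_prop
      exact this.aestronglyMeasurable
    · refine Eventually.of_forall fun n => ae_of_all _ fun x hx => ?_
      rw [uIoc_of_le (by norm_num)] at hx
      have h2 : |x - t| ≤ 2 := abs_le.2 ⟨by linarith [hx.1, ht.2], by linarith [hx.2, ht.1]⟩
      have h3 : |1 - 1 / 4 * (x - t) ^ 2| ≤ 1 := by
        have := sq_abs (x - t)
        have h4 : |x - t| ^ 2 ≤ 4 := by nlinarith [abs_nonneg (x - t)]
        exact abs_le.2 ⟨by nlinarith [sq_nonneg (x - t)], by nlinarith [sq_nonneg (x - t)]⟩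
      have h5 : |F n 0 x| ≤ 2 ^ k := by
        rw [hF0, abs_mul, abs_pow, abs_pow]
        calc |x - t| ^ k * |1 - 1 / 4 * (x - t) ^ 2| ^ n ≤ 2 ^ k * 1 := by
              gcongr
              exact pow_le_one₀ (abs_nonneg _) h3
          _ = 2 ^ k := mul_one _
      rw [Real.norm_eq_abs, abs_mul]
      gcongr
    · simp
    · have h1 : ∀ᵐ x : ℝ, x ≠ t := by simp [ae_iff]
      filter_upwards [h1] with x hxt hx
      rw [uIoc_of_le (by norm_num)] at hx
      have h2 : |x - t| < 2 := abs_lt.2 ⟨by linarith [hx.1, ht.2], by linarith [hx.2, ht.1]⟩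
      have h0 : 0 < |x - t| := abs_pos.2 (sub_ne_zero.2 hxt)
      have h3 : |1 - 1 / 4 * (x - t) ^ 2| < 1 := by
        have := sq_abs (x - t)
        exact abs_lt.2 ⟨by nlinarith, by nlinarith⟩
      have hl := (tendsto_pow_atTop_nhds_zero_of_abs_lt_one h3).const_mul ((x - t) ^ k)
      have hl2 := hl.mul hl
      simp only [mul_zero] at hl2
      simpa only [hF0] using hl2
  have hl : Tendsto (fun n => M * l2norm (F n 0)) atTop (𝓝 0) := by
    have := ((Real.continuous_sqrt.tendsto 0).comp hlim).const_mul M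
    simpa [l2norm_eq_sqrt, Function.comp_def] using this
  obtain ⟨n, hn⟩ := (hl.eventually (gt_mem_nhds (show (0 : ℝ) < k.factorial by positivity))).exists
  exact ⟨F n, derivTower_of_polynomial _ _ _ _ _, by rw [hFk]; exact hn⟩

open Polynomial in
/-- A polynomial kernel with prescribed jet at `0` and a zero of order `r` at `h`. -/
theorem exists_polynomial_kernel (r m : ℕ) {h : ℝ} (h0 : 0 < h) (h1 : h ≤ 1) :
    ∃ P : ℝ[X], (∀ s < r, (derivative^[s] P).eval 0 = if s = m then 1 else 0) ∧
      (∀ s < r, (derivative^[s] P).eval h = 0) ∧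
      ∀ y ∈ Icc 0 h, |P.eval y| ≤ 1 := by
  let c : ℝ := (h⁻¹) ^ r
  let R : ℝ[X] := 1 - C c * X ^ r
  let a : ℝ := 1 / m.factorial
  have ha : a * m.factorial = 1 := by simp only [a]; field_simp
  -- With R = 1 - (X/h)^r, the power R^r is 1 modulo X^r and vanishes to order `r` at `h`. The bound
  -- 1 on [0, h] does not depend on `h`.
  refine ⟨C a * X ^ m * R ^ r, fun s hs => ?_, fun s hs => ?_, fun y hy => ?_⟩
  · obtain ⟨Q, hQ⟩ : X ^ r ∣ R ^ r - 1 := by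
      have h2 : R - 1 ∣ R ^ r - 1 ^ r := sub_dvd_pow_sub_pow R 1 r
      rw [one_pow] at h2
      exact Dvd.dvd.trans ⟨-C c, by simp only [R]; ring⟩ h2
    have e : C a * X ^ m * R ^ r = C a * X ^ m + X ^ r * (Q * C a * X ^ m) := by
      rw [show R ^ r = 1 + X ^ r * Q by rw [← hQ]; ring]
      ring
    rw [eval_zero_iterate_derivative, e, coeff_add, coeff_X_pow_mul', if_neg (by omega),
      coeff_C_mul_X_pow, add_zero]
    split_ifs with hsm
    · rw [hsm, mul_comm, ha]
    · simp
  · have hroot : X - C h ∣ R := by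
      rw [dvd_iff_isRoot]
      simp only [R, IsRoot.def, c, eval_sub, eval_one, eval_mul, eval_C, eval_pow, eval_X]
      rw [← mul_pow, inv_mul_cancel₀ h0.ne', one_pow, sub_self]
    have hdvd : (X - C h) ^ r ∣ C a * X ^ m * R ^ r :=
      Dvd.dvd.mul_left (pow_dvd_pow_of_dvd hroot r) _
    obtain ⟨Q, hQ⟩ := pow_sub_dvd_iterate_derivative_of_pow_dvd s hdvd
    rw [hQ]
    simp [show r - s ≠ 0 by omega]
  · have hy1 : 0 ≤ (h⁻¹ * y) ^ r := by have := hy.1; positivity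
    have hy2 : (h⁻¹ * y) ^ r ≤ 1 := by
      apply pow_le_one₀ (by have := hy.1; positivity)
      rw [inv_mul_le_iff₀ h0]
      simpa using hy.2
    have e : (C a * X ^ m * R ^ r).eval y = a * y ^ m * (1 - (h⁻¹ * y) ^ r) ^ r := by
      simp [R, c, mul_pow]
    have ha0 : 0 ≤ a := by positivity
    have ha1 : a ≤ 1 := by
      simp only [a]
      rw [div_le_one (by positivity)]
      exact_mod_cast m.factorial_pos
    have hb0 : 0 ≤ 1 - (h⁻¹ * y) ^ r := by linarith
    have hy0 := hy.1
    rw [e, abs_of_nonneg (by positivity)]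
    exact mul_le_one₀ (mul_le_one₀ ha1 (by positivity) (pow_le_one₀ hy0 (hy.2.trans h1)))
      (by positivity) (pow_le_one₀ hb0 (by linarith))

/-- The coefficient of the highest derivative can be made arbitrarily small. -/
theorem exists_abs_le_add_small {r k : ℕ} (hk : k < r) {t : ℝ} (ht : t ∈ Ioo (-1 : ℝ) 1)
    {ε : ℝ} (hε : 0 < ε) : ∃ C : ℝ, 0 ≤ C ∧ ∀ F : ℕ → ℝ → ℝ, DerivTower r F (-1) 1 →
      |F k t| ≤ C * l2norm (F 0) + ε * l2norm (F r) := by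
  -- Green's formula on [t, t + h] with the polynomial kernel `V` makes ‖V 0‖ the coefficient of the
  -- top derivative. As |V 0| ≤ 1, this norm is at most √h ≤ ε; the other bounds on `h` keep the
  -- interval inside [-1, 1] and h ≤ 1.
  let h := min (ε ^ 2) (min (1 - t) 1)
  have h0 : 0 < h := lt_min (by positivity) (lt_min (by linarith [ht.2]) one_pos)
  have hh1 : h ≤ 1 := (min_le_right _ _).trans (min_le_right _ _)
  have hht : t + h ≤ 1 := by
    have : h ≤ 1 - t := (min_le_right _ _).trans (min_le_left _ _)
    linarith
  have hhε : h ≤ ε ^ 2 := min_le_left _ _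
  obtain ⟨P, hP0, hPh, hP1⟩ := exists_polynomial_kernel r (r - k - 1) h0 hh1
  have hle : t ≤ t + h := by linarith
  have hV := derivTower_of_polynomial P t r t (t + h)
  set V : ℕ → ℝ → ℝ := fun i x => (Polynomial.derivative^[i] P).eval (x - t) with hVdef
  refine ⟨Real.sqrt (∫ x in t..(t + h), V r x * V r x), Real.sqrt_nonneg _, fun F hF => ?_⟩
  have hF' := hF.mono ht.1.le hle hht
  have hg := DerivTower.green hle hV hF'
  have hsum : ∑ s ∈ Finset.range r, (-1 : ℝ) ^ s *
      (V s (t + h) * F (r - 1 - s) (t + h) - V s t * F (r - 1 - s) t) =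
      -((-1) ^ (r - k - 1) * F k t) := by
    rw [Finset.sum_eq_single (r - k - 1)]
    · simp only [hVdef, add_sub_cancel_left, sub_self]
      rw [hPh _ (by omega), hP0 _ (by omega), if_pos rfl, show r - 1 - (r - k - 1) = k by omega]
      ring
    · intro s hs hne
      rw [Finset.mem_range] at hs
      simp only [hVdef, add_sub_cancel_left, sub_self]
      rw [hPh _ hs, hP0 _ hs, if_neg hne]
      ring
    · intro hn
      exact absurd (Finset.mem_range.2 (by omega)) hn
  rw [hsum] at hg
  have habs : |F k t| = |(-1) ^ r * (∫ x in t..(t + h), V r x * F 0 x) -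
      ∫ x in t..(t + h), V 0 x * F r x| := by
    rw [hg, show ∀ p q : ℝ, p - (-q + p) = q from fun p q => by ring, abs_mul]
    simp
  have c1 := abs_integral_mul_le hle (hV.memLp hle le_rfl) (hF'.memLp hle (Nat.zero_le r))
  have c2 := abs_integral_mul_le hle (hV.memLp hle (Nat.zero_le r)) (hF'.memLp hle le_rfl)
  have n1 := sqrt_integral_le_l2norm ht.1.le hle hht (hF.memLp (by norm_num) (Nat.zero_le r))
  have n2 := sqrt_integral_le_l2norm ht.1.le hle hht (hF.memLp (by norm_num) le_rfl)
  have n3 : Real.sqrt (∫ x in t..(t + h), V 0 x * V 0 x) ≤ ε := by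
    apply Real.sqrt_le_iff.2 ⟨hε.le, ?_⟩
    have : ∫ x in t..(t + h), V 0 x * V 0 x ≤ ∫ x in t..(t + h), (1 : ℝ) := by
      apply intervalIntegral.integral_mono_on hle
      · exact intervalIntegrable_mul_of_memLp hle (hV.memLp hle (Nat.zero_le r))
          (hV.memLp hle (Nat.zero_le r))
      · exact intervalIntegrable_const
      · intro x hx
        have hx1 := hP1 (x - t) ⟨by linarith [hx.1], by linarith [hx.2]⟩
        have hx2 : |V 0 x| ≤ 1 := by simpa [hVdef] using hx1
        rw [← abs_mul_abs_self]
        exact mul_le_one₀ hx2 (abs_nonneg _) hx2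
    refine this.trans ?_
    simpa using hhε
  rw [habs]
  refine (abs_sub _ _).trans ?_
  rw [abs_mul, abs_pow, abs_neg, abs_one, one_pow, one_mul]
  refine add_le_add (c1.trans ?_) (c2.trans ?_)
  · gcongr
  · gcongr

/-- Every square integrable function is the last member of a tower. -/
theorem exists_tower_with_last {a b : ℝ} (hab : a ≤ b) (n : ℕ) {g : ℝ → ℝ}
    (hg : MemLp g 2 (volume.restrict (Icc a b))) :
    ∃ F : ℕ → ℝ → ℝ, DerivTower n F a b ∧ F n = g := by
  let J : (ℝ → ℝ) → ℝ → ℝ := fun f x => ∫ y in a..x, f y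
  have hac : ∀ f, MemLp f 2 (volume.restrict (Icc a b)) →
      AbsolutelyContinuousOnInterval (J f) a b := fun f hf =>
    (intervalIntegrable_of_memLp hab hf).absolutelyContinuousOnInterval_intervalIntegral
      left_mem_uIcc
  have hI : ∀ j, MemLp (J^[j] g) 2 (volume.restrict (Icc a b)) := by
    intro j
    induction j with
    | zero => exact hg
    | succ j ih =>
      rw [Function.iterate_succ_apply']
      have := (hac _ ih).continuousOn
      rw [uIcc_of_le hab] at this
      exact memLp_of_continuousOn_Icc this
  refine ⟨fun i => J^[n - i] g, ⟨fun i hi => ?_, fun i hi => ?_, hI _⟩, by simp⟩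
  · rw [show n - i = n - (i + 1) + 1 by omega, Function.iterate_succ_apply']
    exact hac _ (hI _)
  · rw [show n - i = n - (i + 1) + 1 by omega, Function.iterate_succ_apply']
    filter_upwards [(intervalIntegrable_of_memLp hab (hI (n - (i + 1)))).ae_hasDerivAt_integral]
      with x hx hx'
    exact hx (by rwa [uIcc_of_le hab]) a left_mem_uIcc

/-! ### Comparing the norms for different parameters -/

/-- `U 0` and `U r` represent the functional `f ↦ f⁽ᵏ⁾(t)`, and `U r, …, U (2 r)` is a tower whose
last member is proportional to `U 0`. -/
structure Represents (r k : ℕ) (t lam : ℝ) (U : ℕ → ℝ → ℝ) : Prop where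
  memLp_zero : MemLp (U 0) 2 (volume.restrict (Icc (-1 : ℝ) 1))
  tower : DerivTower r (fun i => U (r + i)) (-1) 1
  last_eq : ∀ x, U (r + r) x = (-1) ^ (r + 1) * lam * U 0 x
  eval_eq : ∀ F : ℕ → ℝ → ℝ, DerivTower r F (-1) 1 →
    F k t = (-1) ^ (r + 1) * (∫ x in (-1 : ℝ)..1, U 0 x * F r x) +
      ∫ x in (-1 : ℝ)..1, U r x * F 0 x

theorem IsKernel.represents_glueDeriv {r k : ℕ} {t lam : ℝ} {L G : ℝ → ℝ}
    (h : IsKernel r k t lam L G) (hk : k < r) (ht : t ∈ Ioo (-1 : ℝ) 1) :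
    Represents r k t lam (glueDeriv t L G) where
  memLp_zero := h.memLp_glueDeriv 0 _ _
  tower := h.derivTower (by omega) ht
  last_eq x := by
    have := h.glueDeriv_ode 0 x
    rwa [add_zero, two_mul] at this
  eval_eq _ hF := h.represents hk ht hF

namespace Represents

variable {r k : ℕ} {t lam mu : ℝ} {U V : ℕ → ℝ → ℝ}

theorem memLp_mid (h : Represents r k t lam U) :
    MemLp (U r) 2 (volume.restrict (Icc (-1 : ℝ) 1)) := by
  simpa using h.tower.memLp (by norm_num) (Nat.zero_le r)

theorem l2norm_last (h : Represents r k t lam U) (hlam : 0 ≤ lam) :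
    l2norm (U (r + r)) = lam * l2norm (U 0) := by
  rw [show U (r + r) = fun x => (-1) ^ (r + 1) * lam * U 0 x from funext h.last_eq,
    l2norm_const_mul, abs_mul, abs_pow, abs_neg, abs_one, one_pow, one_mul, abs_of_nonneg hlam]

theorem eval_tower (hV : Represents r k t mu V) (hU : Represents r k t lam U) :
    U (r + k) t = lam * (∫ x in (-1 : ℝ)..1, V 0 x * U 0 x) +
      ∫ x in (-1 : ℝ)..1, V r x * U r x := by
  have h := hV.eval_eq _ hU.tower
  have e : ∫ x in (-1 : ℝ)..1, V 0 x * U (r + r) x =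
      (-1) ^ (r + 1) * (lam * ∫ x in (-1 : ℝ)..1, V 0 x * U 0 x) := by
    rw [← intervalIntegral.integral_const_mul, ← intervalIntegral.integral_const_mul]
    congr 1
    ext x
    rw [hU.last_eq]
    ring
  rw [e, ← mul_assoc, ← mul_pow] at h
  simpa using h

theorem eval_self (h : Represents r k t lam U) :
    U (r + k) t = lam * l2norm (U 0) ^ 2 + l2norm (U r) ^ 2 := by
  rw [h.eval_tower h, l2norm_sq, l2norm_sq]

theorem abs_eval_le (h : Represents r k t lam U) {F : ℕ → ℝ → ℝ} (hF : DerivTower r F (-1) 1) :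
    |F k t| ≤ l2norm (U r) * l2norm (F 0) + l2norm (U 0) * l2norm (F r) := by
  rw [h.eval_eq F hF]
  refine (abs_add_le _ _).trans ?_
  rw [abs_mul, abs_pow, abs_neg, abs_one, one_pow, one_mul, add_comm]
  exact add_le_add
    (abs_integral_mul_le_l2norm h.memLp_mid (hF.memLp (by norm_num) (Nat.zero_le r)))
    (abs_integral_mul_le_l2norm h.memLp_zero (hF.memLp (by norm_num) le_rfl))

/-- The value at `t` of the `k`-th derivative of `U r` can be computed from either representation.
That of `U` gives the left side exactly; that of `V`, with Cauchy–Schwarz, gives the right side as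
an upper bound. -/
theorem energy_le (hU : Represents r k t lam U) (hV : Represents r k t mu V) (hlam : 0 ≤ lam) :
    lam * l2norm (U 0) ^ 2 + l2norm (U r) ^ 2 ≤
      lam * (l2norm (V 0) * l2norm (U 0)) + l2norm (V r) * l2norm (U r) := by
  rw [← hU.eval_self, hV.eval_tower hU]
  gcongr
  · exact (le_abs_self _).trans (abs_integral_mul_le_l2norm hV.memLp_zero hU.memLp_zero)
  · exact (le_abs_self _).trans (abs_integral_mul_le_l2norm hV.memLp_mid hU.memLp_mid)

/-- For parameter 0 the test function `U r` has zero `r`-th derivative, so the `B` term drops out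
and ‖U r‖² ≤ A‖U r‖. -/
theorem l2norm_mid_le_of_zero (hU : Represents r k t 0 U) {A B : ℝ} (hA : 0 ≤ A)
    (h : ∀ F : ℕ → ℝ → ℝ, DerivTower r F (-1) 1 →
      |F k t| ≤ A * l2norm (F 0) + B * l2norm (F r)) : l2norm (U r) ≤ A := by
  have h1 := h _ hU.tower
  simp only [add_zero] at h1
  rw [hU.l2norm_last le_rfl, hU.eval_self] at h1
  have h2 := (le_abs_self _).trans h1
  by_contra! hlt
  nlinarith [l2norm_nonneg (U r)]

theorem l2norm_zero_le (hU : Represents r k t 0 U) (hV : Represents r k t mu V) (hmu : 0 < mu) :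
    l2norm (V 0) ≤ l2norm (U 0) := by
  have h1 := hV.energy_le hU hmu.le
  have h2 := hU.l2norm_mid_le_of_zero (l2norm_nonneg (V r)) fun F hF => hV.abs_eval_le hF
  have h3 : mu * l2norm (V 0) ^ 2 ≤ mu * (l2norm (U 0) * l2norm (V 0)) := by
    nlinarith [l2norm_nonneg (V r)]
  have h4 := le_of_mul_le_mul_left h3 hmu
  by_contra! hlt
  nlinarith [l2norm_nonneg (U 0)]

/-- Adding the two energy inequalities, with p = ‖U 0‖ and q = ‖V 0‖, bounds the square by -λ(p -
q)² + (λ - μ)(q - p)q. This yields continuity of the first constant in the parameter. -/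
theorem sq_sub_le (hU : Represents r k t lam U) (hV : Represents r k t mu V) (hlam : 0 ≤ lam)
    (hmu : 0 ≤ mu) : (l2norm (U r) - l2norm (V r)) ^ 2 ≤
      |lam - mu| * ((l2norm (U 0) + l2norm (V 0)) * l2norm (V 0)) := by
  have h1 := hU.energy_le hV hlam
  have h2 := hV.energy_le hU hmu
  set p := l2norm (U 0)
  set q := l2norm (V 0)
  have hp : 0 ≤ p := l2norm_nonneg _
  have hq : 0 ≤ q := l2norm_nonneg _
  have h3 : (lam - mu) * ((q - p) * q) ≤ |lam - mu| * ((p + q) * q) := by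
    refine (le_abs_self _).trans ?_
    rw [abs_mul, abs_mul, abs_of_nonneg hq]
    gcongr
    exact abs_le.2 ⟨by linarith, by linarith⟩
  have h4 := mul_nonneg hlam (sq_nonneg (p - q))
  nlinarith

/-- Otherwise the functional would be bounded in the norm of L_2. -/
theorem l2norm_zero_pos (hU : Represents r k t lam U) (ht : t ∈ Ioo (-1 : ℝ) 1) :
    0 < l2norm (U 0) := by
  obtain ⟨F, hF, hlt⟩ := exists_tower_mul_l2norm_lt ht r k (l2norm (U r))
  have h1 := (le_abs_self _).trans (hU.abs_eval_le hF)
  rcases (l2norm_nonneg (U 0)).lt_or_eq with h | h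
  · exact h
  · rw [← h] at h1
    linarith

end Represents

/-! ### Sharpness -/

/-- Homogeneous form of an upper bound on the class `W`. -/
theorem sub_le_mul_of_forall_le {r k : ℕ} {t A c : ℝ}
    (h : ∀ F : ℕ → ℝ → ℝ, DerivTower r F (-1) 1 → l2norm (F r) ≤ 1 →
      |F k t| - A * l2norm (F 0) ≤ c)
    {F : ℕ → ℝ → ℝ} (hF : DerivTower r F (-1) 1) (hpos : 0 < l2norm (F r)) :
    |F k t| - A * l2norm (F 0) ≤ c * l2norm (F r) := by
  have hi : 0 ≤ (l2norm (F r))⁻¹ := by positivity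
  have h1 := h _ (hF.const_mul (l2norm (F r))⁻¹) (by
    rw [l2norm_const_mul, abs_of_nonneg hi, inv_mul_cancel₀ hpos.ne'])
  rw [l2norm_const_mul, abs_mul, abs_of_nonneg hi] at h1
  have e : (l2norm (F r))⁻¹ * |F k t| - A * ((l2norm (F r))⁻¹ * l2norm (F 0)) =
      (|F k t| - A * l2norm (F 0)) / l2norm (F r) := by
    field_simp
  rw [e, div_le_iff₀ hpos] at h1
  exact h1

namespace Represents

variable {r k : ℕ} {t lam : ℝ} {U : ℕ → ℝ → ℝ}

theorem l2norm_zero_le_of_forall_le (hU : Represents r k t lam U) (ht : t ∈ Ioo (-1 : ℝ) 1)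
    (hlam : 0 ≤ lam) {c : ℝ}
    (h : ∀ F : ℕ → ℝ → ℝ, DerivTower r F (-1) 1 → l2norm (F r) ≤ 1 →
      |F k t| - l2norm (U r) * l2norm (F 0) ≤ c) : l2norm (U 0) ≤ c := by
  have hB := hU.l2norm_zero_pos ht
  rcases hlam.lt_or_eq with hlam | rfl
  · have h1 := sub_le_mul_of_forall_le h hU.tower (by rw [hU.l2norm_last hlam.le]; positivity)
    rw [hU.l2norm_last hlam.le, hU.eval_self] at h1
    simp only [add_zero] at h1
    have h2 := (sub_le_sub_right (le_abs_self _) _).trans h1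
    have h3 : lam * l2norm (U 0) * l2norm (U 0) ≤ lam * l2norm (U 0) * c := by linarith
    exact le_of_mul_le_mul_left h3 (by positivity)
  -- For parameter 0, `U r` has zero `r`-th derivative and cannot be normalized. Adding `E` gives
  -- N·U r + E an `r`-th derivative of norm ‖U 0‖, whatever `N` is.
  · obtain ⟨E, hE, hlast⟩ := exists_tower_with_last (by norm_num) r
      (hU.memLp_zero.const_mul ((-1) ^ (r + 1)))
    have hE0 := hE.memLp (by norm_num) (Nat.zero_le r)
    set q := ∫ x in (-1 : ℝ)..1, E 0 x * E 0 x
    have key : ∀ N : ℝ, 0 < N → 2 * N * (l2norm (U 0) ^ 2 - c * l2norm (U 0)) ≤ q := by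
      intro N hN
      have hT := (hU.tower.const_mul N).add hE
      have hr : l2norm (fun x => N * U (r + r) x + E r x) = l2norm (U 0) := by
        have : (fun x => N * U (r + r) x + E r x) = fun x => (-1) ^ (r + 1) * U 0 x := by
          ext x
          rw [hU.last_eq, hlast]
          ring
        rw [this, l2norm_const_mul, abs_pow, abs_neg, abs_one, one_pow, one_mul]
      have h1 := sub_le_mul_of_forall_le h hT (by rw [hr]; exact hB)
      simp only [add_zero] at h1
      rw [hr, hU.eval_self] at h1
      have hk1 : E k t = l2norm (U 0) ^ 2 + ∫ x in (-1 : ℝ)..1, U r x * E 0 x := by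
        rw [hU.eval_eq E hE, l2norm_sq, ← intervalIntegral.integral_const_mul, hlast]
        congr 2
        ext x
        have : ((-1 : ℝ) ^ (r + 1)) * (-1) ^ (r + 1) = 1 := by rw [← mul_pow]; simp
        linear_combination (U 0 x * U 0 x) * this
      have hsq : l2norm (fun x => N * U r x + E 0 x) ^ 2 =
          N ^ 2 * l2norm (U r) ^ 2 + 2 * N * (∫ x in (-1 : ℝ)..1, U r x * E 0 x) + q := by
        have i1 := intervalIntegrable_mul_of_memLp (by norm_num) hU.memLp_mid hU.memLp_mid
        have i2 := intervalIntegrable_mul_of_memLp (by norm_num) hU.memLp_mid hE0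
        have i3 := intervalIntegrable_mul_of_memLp (by norm_num) hE0 hE0
        have : ∀ x, (N * U r x + E 0 x) * (N * U r x + E 0 x) =
            N ^ 2 * (U r x * U r x) + 2 * N * (U r x * E 0 x) + E 0 x * E 0 x := fun x => by ring
        rw [l2norm_sq, l2norm_sq]
        simp only [this]
        rw [intervalIntegral.integral_add ((i1.const_mul _).add (i2.const_mul _)) i3,
          intervalIntegral.integral_add (i1.const_mul _) (i2.const_mul _),
          intervalIntegral.integral_const_mul, intervalIntegral.integral_const_mul]
      set y := l2norm (fun x => N * U r x + E 0 x)
      have h2 := (sub_le_sub_right (le_abs_self _) _).trans h1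
      rw [hk1] at h2
      -- This gives 2N‖U r‖y ≤ N²‖U r‖² + y². After inserting `hsq` and `hk1`, the terms in N² and
      -- the cross terms cancel, leaving the bound `q` independent of `N`.
      have h3 := sq_nonneg (y - N * l2norm (U r))
      have h4 := mul_le_mul_of_nonneg_left h2 (show 0 ≤ 2 * N by linarith)
      nlinarith
    by_contra! hlt
    have hd : 0 < l2norm (U 0) ^ 2 - c * l2norm (U 0) := by nlinarith
    have hq : 0 ≤ q := intervalIntegral.integral_nonneg (by norm_num) fun x _ => mul_self_nonneg _
    have h1 := key ((q + 1) / (l2norm (U 0) ^ 2 - c * l2norm (U 0))) (by positivity)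
    rw [mul_assoc, div_mul_cancel₀ _ hd.ne'] at h1
    linarith

end Represents

/-! ### The range of the first constant -/

/-- If A(λ) ≤ M for all λ, a test function concentrated at `t` forces B(λ) ≥ c > 0. An inequality
with top coefficient c/2, applied to u^{(r)}, then gives λB(B - c/2) ≤ CM, which fails for large λ.
-/
theorem exists_lt_l2norm_mid {r k : ℕ} (hk : k < r) {t : ℝ} (ht : t ∈ Ioo (-1 : ℝ) 1)
    {U : ℝ → ℕ → ℝ → ℝ} (hU : ∀ lam, 0 ≤ lam → Represents r k t lam (U lam)) (M : ℝ) :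
    ∃ lam, 0 ≤ lam ∧ M < l2norm (U lam r) := by
  by_contra! hM
  obtain ⟨F, hF, hlt⟩ := exists_tower_mul_l2norm_lt ht r k M
  have hB : ∀ lam, 0 ≤ lam → F k t - M * l2norm (F 0) ≤ l2norm (U lam 0) * l2norm (F r) := by
    intro lam hlam
    have h1 := (le_abs_self _).trans ((hU lam hlam).abs_eval_le hF)
    have h2 := mul_le_mul_of_nonneg_right (hM lam hlam) (l2norm_nonneg (F 0))
    linarith
  have hFr : 0 < l2norm (F r) := by
    have := hB 0 le_rfl
    rcases (l2norm_nonneg (F r)).lt_or_eq with h | h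
    · exact h
    · rw [← h] at this
      linarith
  set c := (F k t - M * l2norm (F 0)) / l2norm (F r) with hc
  have hc0 : 0 < c := div_pos (by linarith) hFr
  have hcB : ∀ lam, 0 ≤ lam → c ≤ l2norm (U lam 0) := fun lam hlam => by
    rw [hc, div_le_iff₀ hFr]
    exact hB lam hlam
  obtain ⟨C, hC, hsmall⟩ := exists_abs_le_add_small hk ht (half_pos hc0)
  have hM0 : 0 ≤ M := (l2norm_nonneg _).trans (hM 0 le_rfl)
  have hlam : 0 ≤ 2 * (C * M + 1) / c ^ 2 := by positivity
  -- Chosen so that λc²/2 = CM + 1 exceeds CM.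
  set lam := 2 * (C * M + 1) / c ^ 2 with hlamdef
  have hR := hU lam hlam
  have h1 := (le_abs_self _).trans (hsmall _ hR.tower)
  simp only [add_zero] at h1
  rw [hR.l2norm_last hlam, hR.eval_self] at h1
  have h2 := mul_le_mul_of_nonneg_left (hM lam hlam) hC
  have h3 := hcB lam hlam
  have h4 : lam * (c * (c / 2)) ≤ lam * (l2norm (U lam 0) * (l2norm (U lam 0) - c / 2)) := by
    gcongr <;> linarith
  have h5 : lam * (c * (c / 2)) = C * M + 1 := by
    rw [hlamdef]
    field_simp
  nlinarith [sq_nonneg (l2norm (U lam r))]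

theorem exists_l2norm_mid_eq {r k : ℕ} (hk : k < r) {t : ℝ} (ht : t ∈ Ioo (-1 : ℝ) 1)
    {U : ℝ → ℕ → ℝ → ℝ} (hU : ∀ lam, 0 ≤ lam → Represents r k t lam (U lam)) {A : ℝ}
    (hA : l2norm (U 0 r) ≤ A) : ∃ lam, 0 ≤ lam ∧ l2norm (U lam r) = A := by
  obtain ⟨b, hb, hAb⟩ := exists_lt_l2norm_mid hk ht hU A
  have hB : ∀ lam, 0 ≤ lam → l2norm (U lam 0) ≤ l2norm (U 0 0) := by
    intro lam hlam
    rcases hlam.lt_or_eq with h | rfl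
    · exact (hU 0 le_rfl).l2norm_zero_le (hU lam hlam) h
    · exact le_rfl
  have hcont : ContinuousOn (fun lam => l2norm (U lam r)) (Icc 0 b) := by
    intro mu hmu
    set K := (l2norm (U 0 0) + l2norm (U 0 0)) * l2norm (U 0 0)
    have hle : ∀ lam ∈ Icc 0 b,
        |l2norm (U lam r) - l2norm (U mu r)| ≤ Real.sqrt (|lam - mu| * K) := by
      intro lam hlam
      apply Real.abs_le_sqrt
      refine ((hU lam hlam.1).sq_sub_le (hU mu hmu.1) hlam.1 hmu.1).trans ?_
      have h1 := hB lam hlam.1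
      have h2 := hB mu hmu.1
      have h3 := l2norm_nonneg (U mu 0)
      have h4 := l2norm_nonneg (U 0 0)
      gcongr
      exact mul_le_mul (add_le_add h1 h2) h2 h3 (by linarith)
    have hz : Tendsto (fun lam => Real.sqrt (|lam - mu| * K)) (𝓝[Icc 0 b] mu) (𝓝 0) := by
      have : Continuous fun lam => Real.sqrt (|lam - mu| * K) := by fun_prop
      have := this.tendsto mu
      simp only [sub_self, abs_zero, zero_mul, Real.sqrt_zero] at this
      exact this.mono_left nhdsWithin_le_nhds
    rw [ContinuousWithinAt, tendsto_iff_norm_sub_tendsto_zero]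
    refine squeeze_zero' (Eventually.of_forall fun _ => norm_nonneg _) ?_ hz
    filter_upwards [self_mem_nhdsWithin] with lam hlam
    exact hle lam hlam
  obtain ⟨lam, hlam, e⟩ := intermediate_value_Icc hb hcont ⟨hA, hAb.le⟩
  exact ⟨lam, hlam.1, e⟩

/-! ### Sharp pairs in terms of towers, and the theorem -/

/-- The upper bound half of the supremum condition already follows from the inequality on the class
`W`, so only minimality of `p.2` is kept. -/
theorem mem_sharpPairs_iff {r k : ℕ} (hk : k < r) {t : ℝ} (ht : t ∈ Ioo (-1 : ℝ) 1)
    {p : ℝ × ℝ} : p ∈ sharpPairs r k t ↔ 0 ≤ p.1 ∧ 0 ≤ p.2 ∧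
      (∀ F : ℕ → ℝ → ℝ, DerivTower r F (-1) 1 →
        |F k t| ≤ p.1 * l2norm (F 0) + p.2 * l2norm (F r)) ∧
      ∀ c, (∀ F : ℕ → ℝ → ℝ, DerivTower r F (-1) 1 → l2norm (F r) ≤ 1 →
        |F k t| - p.1 * l2norm (F 0) ≤ c) → p.2 ≤ c := by
  have hr : 1 ≤ r := by omega
  have h11 : (-1 : ℝ) < 1 := by norm_num
  have htI : t ∈ Icc (-1 : ℝ) 1 := Ioo_subset_Icc_self ht
  have key : ∀ F : ℕ → ℝ → ℝ, DerivTower r F (-1) 1 → MemSobolev (-1) 1 r (F 0) ∧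
      derivI k (F 0) t = F k t ∧ l2norm (derivI r (F 0)) = l2norm (F r) := fun F hF =>
    ⟨hF.memSobolev hr h11, hF.iteratedDerivWithin_eqOn h11 hk htI,
      l2norm_congr_ae (hF.iteratedDerivWithin_last hr h11)⟩
  have key' : ∀ f : ℝ → ℝ, MemSobolev (-1) 1 r f →
      DerivTower r (fun i => derivI i f) (-1) 1 ∧ derivI 0 f = f := fun f hf =>
    ⟨hf.derivTower hr h11, by ext x; simp [derivI]⟩
  constructor
  · rintro ⟨h1, h2, h3, h4⟩
    refine ⟨h1, h2, fun F hF => ?_, fun c hc => ?_⟩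
    · obtain ⟨hm, ek, er⟩ := key F hF
      have := h3 _ hm
      rwa [ek, er] at this
    · refine h4.2 ?_
      rintro _ ⟨f, hf, rfl⟩
      obtain ⟨hT, e0⟩ := key' f hf.1
      have := hc _ hT hf.2
      rwa [e0] at this
  · rintro ⟨h1, h2, h3, h4⟩
    have h3' : ∀ f : ℝ → ℝ, MemSobolev (-1) 1 r f →
        |derivI k f t| ≤ p.1 * l2norm f + p.2 * l2norm (derivI r f) := by
      intro f hf
      obtain ⟨hT, e0⟩ := key' f hf
      have := h3 _ hT
      rwa [e0] at this
    refine ⟨h1, h2, h3', ?_, fun c hc => h4 c fun F hF hF1 => ?_⟩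
    · rintro _ ⟨f, hf, rfl⟩
      have := h3' f hf.1
      have h5 := mul_le_mul_of_nonneg_left hf.2 h2
      simp only
      linarith
    · obtain ⟨hm, ek, er⟩ := key F hF
      have := hc ⟨F 0, ⟨hm, by rwa [er]⟩, rfl⟩
      simp only at this
      rwa [ek] at this

end LandauKolmogorov

open LandauKolmogorov in
theorem mainTheorem5 (r k : ℕ) (hr : 1 ≤ r) (hk : k ≤ r - 1) (t : ℝ) (ht : t ∈ Set.Ioo (-1 : ℝ) 1) :
    ∃ u : ℝ → ℝ → ℝ,
      (∀ lam : ℝ, 0 ≤ lam →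
        LandauKolmogorov.IsSolution r k t lam (u lam) ∧
        ∀ v : ℝ → ℝ, LandauKolmogorov.IsSolution r k t lam v →
          Set.EqOn v (u lam) (Set.Ioo (-1) t ∪ Set.Ioo t 1)) ∧
      LandauKolmogorov.sharpPairs r k t =
        {p : ℝ × ℝ | ∃ lam : ℝ, 0 ≤ lam ∧
          p = (LandauKolmogorov.l2norm (iteratedDeriv r (u lam)),
            LandauKolmogorov.l2norm (u lam))} := by
  have hkr : k < r := by omega
  have hex : ∀ lam : ℝ, ∃ L G : ℝ → ℝ, 0 ≤ lam → IsKernel r k t lam L G := by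
    intro lam
    by_cases hlam : 0 ≤ lam
    · obtain ⟨L, G, h⟩ := exists_isKernel (k := k) hr t hlam
      exact ⟨L, G, fun _ => h⟩
    · exact ⟨0, 0, fun h => absurd h hlam⟩
  choose L G hLG using hex
  have hU : ∀ lam, 0 ≤ lam → Represents r k t lam (glueDeriv t (L lam) (G lam)) := fun lam hlam =>
    (hLG lam hlam).represents_glueDeriv hkr ht
  have hnorm : ∀ lam, 0 ≤ lam → l2norm (iteratedDeriv r (glueDeriv t (L lam) (G lam) 0)) =
      l2norm (glueDeriv t (L lam) (G lam) r) := by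
    intro lam hlam
    apply l2norm_congr_ae
    -- The derivative of the glued function is controlled only off `t`, a null set for the norm.
    have h1 : ∀ᵐ x : ℝ, x ≠ t := by simp [ae_iff]
    filter_upwards [h1] with x hx _
    exact (hLG lam hlam).iteratedDeriv_glueDeriv hx r
  have hsharp : ∀ lam, 0 ≤ lam → (l2norm (glueDeriv t (L lam) (G lam) r),
      l2norm (glueDeriv t (L lam) (G lam) 0)) ∈ sharpPairs r k t := fun lam hlam =>
    (mem_sharpPairs_iff hkr ht).2 ⟨l2norm_nonneg _, l2norm_nonneg _,
      fun F hF => (hU lam hlam).abs_eval_le hF,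
      fun c hc => (hU lam hlam).l2norm_zero_le_of_forall_le ht hlam hc⟩
  refine ⟨fun lam => glueDeriv t (L lam) (G lam) 0, fun lam hlam =>
    ⟨(hLG lam hlam).isSolution hr ht, fun v hv =>
      hv.eqOn hr ht hlam ((hLG lam hlam).isSolution hr ht)⟩, ?_⟩
  ext p
  constructor
  · intro hp
    have hp' := (mem_sharpPairs_iff hkr ht).1 hp
    obtain ⟨lam, hlam, hA⟩ := exists_l2norm_mid_eq hkr ht hU
      ((hU 0 le_rfl).l2norm_mid_le_of_zero hp'.1 hp'.2.2.1)
    refine ⟨lam, hlam, ?_⟩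
    rw [hnorm lam hlam, hA]
    refine Prod.ext rfl ?_
    have h2 := hsharp lam hlam
    rw [hA] at h2
    -- For a common first entry, both second entries are suprema of the same set.
    exact hp.2.2.2.unique h2.2.2.2
  · rintro ⟨lam, hlam, rfl⟩
    rw [hnorm lam hlam]
    exact hsharp lam hlam
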